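/- **Setting.** Let $R$ be an irreducible simply-laced root system (type $A_n$, $n\ge1$; $D_n$, $n\ge4$; $E_6,E_7,E_8$), $\mathsf v$ a vertex of its Dynkin diagram, and label the vertices by $$\mathrm{Vert}=\{1,\dots,l\}\sqcup\{\underline 2,\dots,\underline{l'}\}\sqcup\{\underline{\underline{k+1}},\dots,\underline{\underline{l''}}\}$$ so that $\mathsf v$ is labelled $1$ and two vertices are joined by an edge exactly if one is the predecessor of the other. Here $i-1\in\mathrm{Vert}\cup\{0\}$ denotes the predecessor of $i$, with $\underline 2-1:=1$ and $\underline{\underline{k+1}}-1:=k$. Further, $l'=1$ if and only if $\mathsf v$ is an extremity of the diagram (has at most one neighbour); $k=l=l''$ in type $A$; and in types $D,E$ the trivalent vertex is labelled $k$, with $1\le k<\min(l,l'')$. Let $L=\mathbb Z\varepsilon\oplus Q_R$, where $Q_R$ is the root lattice, with simple coroots extended by $\alpha_1^\vee(\varepsilon)=-1$ and $\alpha_i^\vee(\varepsilon)=0$ for $i\neq1$. Let the Weyl group $W_0$ act on $L$ through $r_i(x)=x-\alpha_i^\vee(x)\alpha_i$. Put $\delta_0=\varepsilon$, $\delta_i=\delta_{i-1}+\alpha_i$;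 then $\mathcal B=(\delta_j)_{j\in\mathrm{Vert}\cup\{0\}}$ is a $\mathbb Z$-basis of $L$. **The algebra and its calibrated spectrum.** Let $q$ be an indeterminate. $H=H(R,\mathsf v)$ is the $\mathbb C[q,q^{-1}]$-algebra generated by $g_i$ ($i\in\mathrm{Vert}$) and $X^x$ ($x\in L$) with relations $X^0=1$, $X^xX^{y}=X^{x+y}$, $g_i^2=(q-q^{-1})g_i+1$, the braid relations $g_ig_jg_i\cdots=g_jg_ig_j\cdots$ ($m_{ij}$ factors on each side, $m_{ij}$ the order of $r_ir_j$, for $i\ne j$), and $$g_iX^x-X^{r_i(x)}g_i=(q-q^{-1})\frac{X^x-X^{r_i(x)}}{1-X^{-\alpha_i}} .$$ Put $X_j:=X^{\delta_j}$. A finite-dimensional representation of $\mathbb C(q)\otimes_{\mathbb C[q,q^{-1}]}H$ is *calibrated* if every $X^x$ acts diagonalizably. The *calibrated spectrum* $\text{C-Spec}(H)$ is the set of characters $\chi\in\mathrm{Hom}(L,\mathbb C(q)^\times)$ for which some calibrated representation contains a vector $w\neq0$ with $X^xw=\chi(x)w$ for all $x\in L$. Let $\mathrm{Seq}_{R,\mathsf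 v}$ be the set of families $S=(s_j)_{j\in\mathrm{Vert}\cup\{0\}}$ in $\mathbb C(q)^\times$. It is identified with $\mathrm{Hom}(L,\mathbb C(q)^\times)$ through $\chi\mapsto(\chi(\delta_j))_j$, and $\text{C-Eig}(\mathcal B)\subset\mathrm{Seq}_{R,\mathsf v}$ is the set of sequences corresponding to $\text{C-Spec}(H)$. **Truncated orbits.** $W_0$ acts on characters by $w(\chi)(x)=\chi(w^{-1}(x))$, hence on $\mathrm{Seq}_{R,\mathsf v}$. On $\mathrm{Seq}_{R,\mathsf v}\cup\{\mathbf 0\}$ put $\overline r_i(\mathbf 0)=\mathbf 0$, $\overline r_i(S)=\mathbf 0$ if $s_i=q^{2}s_{i-1}$ or $s_i=q^{-2}s_{i-1}$, and $\overline r_i(S)=r_i(S)$ otherwise. For a reduced expression $w=r_{a_1}\cdots r_{a_m}$ put $\overline w=\overline r_{a_1}\cdots\overline r_{a_m}$; this does not depend on the reduced expression. The truncated orbit is $\mathcal O_S=\{\overline w(S)\mid w\in W_0\}\setminus\{\mathbf 0\}$. **Tableaux.** A skew diagram is a finite set of nodes $(x,y)\in\mathbb Z^2$ (row $x$, column $y$)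 that is the translate along the diagonal of $\lambda\setminus\mu$ for Young diagrams $\mu\subset\lambda$. A placed skew diagram is a finite set of pairs $(\Gamma_a,\gamma_a)$ of a non-empty skew diagram and a place $\gamma_a\in\mathbb C(q)^\times$, with $\gamma_a\notin q^{2\mathbb Z}\gamma_b$ for $a\ne b$. A standard tableau of size $N$ is a filling of the $N$ nodes of a placed skew diagram by $0,\dots,N-1$, each used once, ascending along rows and down columns, up to the following equivalence (numbers move with their nodes): connected components of a skew diagram (generated by lying in the same diagonal or in adjacent diagonals) may be translated along the diagonal, and $(\Gamma,\gamma)$ may be replaced by $(\Gamma',\gamma q^{2a})$, $a\in\mathbb Z$, with $\Gamma'$ the translate of $\Gamma$ by $a$ steps to the left. The content $\mathrm c_i(T)$ is $\gamma q^{2(y-x)}$ if the number $i$ is in the node $(x,y)$ at the place $\gamma$. $\mathrm{STab}(R,\mathsf v)$ is the set of triples $T=(T_1,T_2,T_3)$ of standard tableaux of sizes $l+1$, $l'+1$, $l''+1$ such that $T_1,T_2$ coincide after restriction to the numbers $0,1$, and $T_1,T_3$ coincide after restriction to the numbers $0,\dots,k$. Its sequence of contents $\mathrm{Seq}(T)\in\mathrm{Seq}_{R,\mathsf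 v}$ has the entries $\mathrm c_a(T_1)$ at $a=0,\dots,l$, $\mathrm c_b(T_2)$ at $\underline b$ and $\mathrm c_c(T_3)$ at $\underline{\underline c}$. $T$ is *admissible* if every element of $\mathcal O_{\mathrm{Seq}(T)}$ is $\mathrm{Seq}(T')$ for some $T'\in\mathrm{STab}(R,\mathsf v)$; $\mathrm{ASTab}(R,\mathsf v)$ is the set of admissible $T$. **Theorem.** The calibrated spectrum of $H(R,\mathsf v)$ is in bijection with $\mathrm{ASTab}(R,\mathsf v)$, a character $\chi$ corresponding to the tableau $T$ with $\chi(\delta_j)=\mathrm{Seq}(T)_j$ for all $j\in\mathrm{Vert}\cup\{0\}$. In particular $$\text{C-Eig}(\mathcal B)=\{\mathrm{Seq}(T)\mid T\in\mathrm{ASTab}(R,\mathsf v)\}.$$ -/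

import Mathlib

open scoped LaurentPolynomial TensorProduct

namespace CalibratedHecke

/-! ### The ground field `ℂ(q)` -/

/-- The field `ℂ(q)`. -/
abbrev Cq : Type := RatFunc ℂ

/-- The indeterminate `q`, as an element of `ℂ(q)ˣ`. -/
noncomputable def q : Cqˣ := Units.mk0 RatFunc.X RatFunc.X_ne_zero

/-- The inclusion `ℂ[q, q⁻¹] ⊆ ℂ(q)`. -/
noncomputable instance algebraLaurentCq : Algebra ℂ[T;T⁻¹] Cq :=
  (LaurentPolynomial.eval₂ (algebraMap ℂ Cq) q).toAlgebra

/-! ### Root data (through simple roots and coroots) and affine Hecke algebras -/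

/-- A lattice `T` with simple roots `α_i ∈ T` and simple coroots `α_i^∨ ∈ Hom(T, ℤ)`. -/
structure SimpleRootDatum (I T : Type*) [AddCommGroup T] where
  root : I → T
  coroot : I → T →+ ℤ
  coroot_root_self : ∀ i, coroot i (root i) = 2

section General

variable {I T : Type*} [AddCommGroup T] (D : SimpleRootDatum I T)

/-- The simple reflection `r_i(x) = x - α_i^∨(x) α_i` of `T`. -/
def SimpleRootDatum.refl (i : I) : T ≃ₗ[ℤ] T :=
  AddEquiv.toIntLinearEquiv
    { toFun := fun x => x - D.coroot i x • D.root i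
      invFun := fun x => x - D.coroot i x • D.root i
      left_inv := fun x => by
        simp only [map_sub, map_zsmul, D.coroot_root_self, smul_eq_mul, sub_smul]
        module
      right_inv := fun x => by
        simp only [map_sub, map_zsmul, D.coroot_root_self, smul_eq_mul, sub_smul]
        module
      map_add' := fun x y => by
        simp only [map_add, add_smul]
        abel }

/-- The Weyl group `W₀`, acting on `T`. -/
def SimpleRootDatum.weylGroup : Subgroup (T ≃ₗ[ℤ] T) :=
  Subgroup.closure (Set.range D.refl)

/-- The element `r_{a_1} ⋯ r_{a_m}` of the Weyl group. -/
def SimpleRootDatum.wordProd (a : List I) : T ≃ₗ[ℤ] T := (a.map D.refl).prod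

/-- `a` is a reduced expression for `w`: `w = r_{a_1} ⋯ r_{a_m}` with `m` minimal. -/
def SimpleRootDatum.IsReducedExpr (a : List I) (w : T ≃ₗ[ℤ] T) : Prop :=
  D.wordProd a = w ∧ ∀ a' : List I, D.wordProd a' = w → a.length ≤ a'.length

/-- The product `x y x ⋯` with `m` factors. -/
def altProd {A : Type*} [Monoid A] : ℕ → A → A → A
  | 0, _, _ => 1
  | m + 1, x, y => x * altProd m y x

/-- The generators `g_i` and `X^x` of the affine Hecke algebra. -/
inductive HeckeGen (I T : Type*)
  | g (i : I)
  | X (x : T)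

/-- The free `ℂ[q, q⁻¹]`-algebra on the generators. -/
abbrev FreeHecke (I T : Type*) : Type _ := FreeAlgebra ℂ[T;T⁻¹] (HeckeGen I T)

/-- The generator `g_i` of the free algebra. -/
noncomputable def fg (T : Type*) {I : Type*} (i : I) : FreeHecke I T :=
  FreeAlgebra.ι _ (HeckeGen.g i)

/-- The generator `X^x` of the free algebra. -/
noncomputable def fX (I : Type*) {T : Type*} (x : T) : FreeHecke I T :=
  FreeAlgebra.ι _ (HeckeGen.X x)

/-- The scalar `q - q⁻¹` of `ℂ[q, q⁻¹]`. -/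
noncomputable def qq : ℂ[T;T⁻¹] := LaurentPolynomial.T 1 - LaurentPolynomial.T (-1)

/-- The polynomial `(X^x - X^{r_i(x)}) / (1 - X^{-α_i})`, written out: it is
`∑_{k < n} X^{x - k α_i}` if `n = α_i^∨(x) ≥ 0`, and `-∑_{k < -n} X^{r_i(x) - k α_i}`
if `n ≤ 0`. -/
noncomputable def lusztigQuotient (i : I) (x : T) : FreeHecke I T :=
  (∑ k ∈ Finset.range (D.coroot i x).toNat, fX I (x - k • D.root i)) -
    ∑ k ∈ Finset.range (-D.coroot i x).toNat, fX I (D.refl i x - k • D.root i)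

/-- The defining relations of the affine Hecke algebra; `m_{ij}` is the order of `r_i r_j`. -/
inductive HeckeRel : FreeHecke I T → FreeHecke I T → Prop
  | X_zero : HeckeRel (fX I 0) 1
  | X_add (x y : T) : HeckeRel (fX I x * fX I y) (fX I (x + y))
  | quadratic (i : I) : HeckeRel (fg T i * fg T i) (qq • fg T i + 1)
  | braid (i j : I) (hij : i ≠ j) :
      HeckeRel (altProd (orderOf (D.refl i * D.refl j)) (fg T i) (fg T j))
        (altProd (orderOf (D.refl i * D.refl j)) (fg T j) (fg T i))
  | lusztig (i : I) (x : T) :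
      HeckeRel (fg T i * fX I x - fX I (D.refl i x) * fg T i) (qq • lusztigQuotient D i x)

/-- The affine Hecke algebra `H(R, T)` over `ℂ[q, q⁻¹]`. -/
abbrev AffineHecke : Type _ := RingQuot (HeckeRel D)

/-- The element `X^x` of the affine Hecke algebra. -/
noncomputable def heckeX (x : T) : AffineHecke D :=
  RingQuot.mkAlgHom ℂ[T;T⁻¹] (HeckeRel D) (fX I x)

/-- The algebra `ℂ(q) H(R, T) = ℂ(q) ⊗_{ℂ[q, q⁻¹]} H(R, T)`. -/
abbrev CqHecke : Type _ := Cq ⊗[ℂ[T;T⁻¹]] AffineHecke D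

/-- The element `X^x` of `ℂ(q) H(R, T)`. -/
noncomputable def cqX (x : T) : CqHecke D := 1 ⊗ₜ heckeX D x

/-- A representation of `ℂ(q) H(R, T)` is calibrated if every `X^x` is diagonalizable, that is,
if the space is spanned by eigenvectors of `X^x`. -/
def IsCalibrated {V : Type*} [AddCommGroup V] [Module Cq V]
    (ρ : CqHecke D →ₐ[Cq] Module.End Cq V) : Prop :=
  ∀ x : T, ⨆ c : Cq, Module.End.eigenspace (ρ (cqX D x)) c = ⊤

/-- The group `Hom(T, ℂ(q)ˣ)` of characters of `T`. -/
abbrev Character (T : Type*) [AddCommGroup T] : Type _ := Multiplicative T →* Cqˣ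

/-- The calibrated spectrum: the characters of `T` that occur in some finite-dimensional
calibrated representation of `ℂ(q) H(R, T)`. -/
def CSpec : Set (Character T) :=
  {χ | ∃ (V : Type) (_ : AddCommGroup V) (_ : Module Cq V) (_ : FiniteDimensional Cq V)
      (ρ : CqHecke D →ₐ[Cq] Module.End Cq V), IsCalibrated D ρ ∧
      ∃ w : V, w ≠ 0 ∧ ∀ x : T, ρ (cqX D x) w = (χ (Multiplicative.ofAdd x) : Cq) • w}

/-- The action of an automorphism `w` of `T` on characters, `w(χ)(x) = χ(w⁻¹(x))`. -/
noncomputable def charAct (w : T ≃ₗ[ℤ] T) (χ : Character T) : Character T :=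
  χ.comp (AddMonoidHom.toMultiplicative (LinearEquiv.toAddEquiv w⁻¹).toAddMonoidHom)

end General

/-! ### Labellings of simply-laced Dynkin diagrams -/

/-- The numbers `k, l, l', l''` of a labelling by
`{1, …, k, k+1, …, l} ⊔ {2̲, …, l̲'} ⊔ {k+1, …, l''}` (doubly underlined in the last set). -/
structure LabelShape where
  k : ℕ
  l : ℕ
  l' : ℕ
  l'' : ℕ
  one_le_k : 1 ≤ k
  one_le_l' : 1 ≤ l'
  /-- Either there is no trivalent vertex, with the convention `l = k = l''`, or `k` is the
  trivalent vertex, with arms to `l` and to `l''`. -/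
  branch : (k = l ∧ k = l'') ∨ (k < l ∧ k < l'')
  /-- The two conditions below say that `l' = 1` exactly if the vertex `1` is an extremity: if the
  arm `2̲, …, l̲'` is there then there is another arm, and if there are already two neighbours
  `2` and `2` (doubly underlined) of `1` then the arm `2̲, …, l̲'` is there. -/
  two_le_l : 2 ≤ l' → 2 ≤ l
  two_le_l' : k = 1 → k < l → 2 ≤ l'

theorem LabelShape.k_le_l (s : LabelShape) : s.k ≤ s.l := by
  rcases s.branch with h | h <;> omega

theorem LabelShape.k_le_l'' (s : LabelShape) : s.k ≤ s.l'' := by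
  rcases s.branch with h | h <;> omega

theorem LabelShape.one_le_l (s : LabelShape) : 1 ≤ s.l := s.one_le_k.trans s.k_le_l

/-- The set `Vert` of labels: `main a` is `a` for `1 ≤ a ≤ l`, `und b` is `b̲` for `2 ≤ b ≤ l'`
and `dund c` is the doubly underlined `c` for `k + 1 ≤ c ≤ l''`. -/
inductive LabelShape.Vert (s : LabelShape)
  | main (a : ℕ) (h₁ : 1 ≤ a) (h₂ : a ≤ s.l)
  | und (b : ℕ) (h₁ : 2 ≤ b) (h₂ : b ≤ s.l')
  | dund (c : ℕ) (h₁ : s.k + 1 ≤ c) (h₂ : c ≤ s.l'')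

/-- The label `1`. -/
def LabelShape.vertOne (s : LabelShape) : s.Vert := .main 1 le_rfl s.one_le_l

/-- The label `i - 1` in `Vert ∪ {0}` (with `none` standing for `0`), where by convention
`2̲ - 1 = 1` and the doubly underlined `k + 1` has predecessor `k`. -/
def LabelShape.pred {s : LabelShape} : s.Vert → Option s.Vert
  | .main a h₁ h₂ => if h : a = 1 then none else some (.main (a - 1) (by omega) (by omega))
  | .und b h₁ h₂ => if h : b = 2 then some s.vertOne else some (.und (b - 1) (by omega) (by omega))
  | .dund c h₁ h₂ =>
      if h : c = s.k + 1 then some (.main s.k s.one_le_k s.k_le_l)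
      else some (.dund (c - 1) (by omega) (by omega))

/-- The number carried by a label; `0` for the label `0`. -/
def LabelShape.num {s : LabelShape} : Option s.Vert → ℕ
  | none => 0
  | some (.main a _ _) => a
  | some (.und b _ _) => b
  | some (.dund c _ _) => c

theorem LabelShape.num_pred_lt {s : LabelShape} (i : s.Vert) :
    LabelShape.num (LabelShape.pred i) < LabelShape.num (some i) := by
  cases i <;> simp only [pred] <;> split_ifs <;> simp only [num, vertOne] <;> omega

section RootSystem

variable {ι M N : Type*} [AddCommGroup M] [Module ℝ M] [AddCommGroup N] [Module ℝ N]
variable {P : RootPairing ι ℝ M N} [P.IsCrystallographic]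

/-- A labelling of the Dynkin diagram with `v` labelled by `1`: the vertices are in bijection with
the labels, and two vertices are joined by an edge exactly if one label is the predecessor
of the other. -/
structure Labelling (b : P.Base) (v : b.support) where
  shape : LabelShape
  vertex : shape.Vert ≃ b.support
  vertex_one : vertex shape.vertOne = v
  adjacent_iff : ∀ i j : shape.Vert, i ≠ j →
    (b.cartanMatrix (vertex i) (vertex j) ≠ 0 ↔
      LabelShape.pred i = some j ∨ LabelShape.pred j = some i)

/-- The lattice `L_{R,v} = ℤ ε ⊕ Q_R`. -/
abbrev ExtLattice (P : RootPairing ι ℝ M N) : Type _ := ℤ × P.rootSpan ℤ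

/-- The element `ε` of `L_{R,v}`. -/
def eps (P : RootPairing ι ℝ M N) : ExtLattice P := (1, 0)

variable {b : P.Base} {v : b.support}

open Classical in
/-- The root datum of `H(R, v)`, with simple roots and coroots indexed by the labels; the coroots
are extended from `Q_R` to `L_{R,v}` by `α_1^∨(ε) = -1` and `α_i^∨(ε) = 0` for `i ≠ 1`. -/
noncomputable def Labelling.datum (lab : Labelling b v) :
    SimpleRootDatum lab.shape.Vert (ExtLattice P) where
  root i := (0, P.rootSpanMem ℤ (lab.vertex i))
  coroot i :=
    AddMonoidHom.coprod ((if i = lab.shape.vertOne then (-1 : ℤ) else 0) • AddMonoidHom.id ℤ)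
      (P.coroot'In ℤ (lab.vertex i)).toAddMonoidHom
  coroot_root_self i := by
    simp [RootPairing.coroot'In_rootSpanMem_eq_pairingIn]

/-- The vectors `δ_0 = ε` and `δ_i = δ_{i-1} + α_i`, which form the basis `B_{R,v}`. -/
noncomputable def Labelling.delta (lab : Labelling b v) : Option lab.shape.Vert → ExtLattice P
  | none => eps P
  | some i => lab.delta (LabelShape.pred i) + lab.datum.root i
termination_by j => LabelShape.num j
decreasing_by exact LabelShape.num_pred_lt i

/-- The set `Seq_{R,v}` of sequences in `ℂ(q)ˣ` labelled by `Vert ∪ {0}`. -/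
abbrev Labelling.Seq (lab : Labelling b v) : Type := Option lab.shape.Vert → Cqˣ

/-- The sequence of the values of a character on the basis `B_{R,v}`. -/
noncomputable def Labelling.seqOfChar (lab : Labelling b v) (χ : Character (ExtLattice P)) :
    lab.Seq := fun j => χ (Multiplicative.ofAdd (lab.delta j))

/-- The simple roots form a basis of the root lattice. -/
theorem Labelling.exists_basis (lab : Labelling b v) :
    ∃ B : Module.Basis lab.shape.Vert ℤ (P.rootSpan ℤ),
      ∀ i, B i = P.rootSpanMem ℤ (lab.vertex i) := by
  have hli : LinearIndependent ℤ fun i : lab.shape.Vert => P.root (lab.vertex i) :=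
    (LinearIndependent.restrict_scalars' ℤ b.linearIndepOn_root).comp _ lab.vertex.injective
  have hsub : LinearIndependent ℤ
      fun i : lab.shape.Vert => P.rootSpanMem ℤ (lab.vertex i) :=
    LinearIndependent.of_comp (P.rootSpan ℤ).subtype hli
  refine ⟨Module.Basis.mk hsub ?_, fun i => Module.Basis.mk_apply _ _ i⟩
  rintro ⟨x, hx⟩ -
  have himg : Set.range (fun i : lab.shape.Vert => P.root (lab.vertex i)) =
      P.root '' b.support := by
    ext y
    constructor
    · rintro ⟨i, rfl⟩
      exact ⟨_, (lab.vertex i).2, rfl⟩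
    · rintro ⟨j, hj, rfl⟩
      exact ⟨lab.vertex.symm ⟨j, hj⟩, by simp⟩
  have hx' : x ∈ Submodule.span ℤ
      (Set.range fun i : lab.shape.Vert => P.root (lab.vertex i)) := by
    rw [himg, b.span_int_root_support]
    exact hx
  have hmap : (Submodule.span ℤ
      (Set.range fun i : lab.shape.Vert => P.rootSpanMem ℤ (lab.vertex i))).map
        (P.rootSpan ℤ).subtype =
      Submodule.span ℤ (Set.range fun i : lab.shape.Vert => P.root (lab.vertex i)) := by
    rw [Submodule.map_span, ← Set.range_comp]
    rfl
  rw [← hmap] at hx'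
  obtain ⟨y, hy, hyx⟩ := hx'
  have : y = ⟨x, hx⟩ := Subtype.ext hyx
  exact this ▸ hy

theorem Labelling.delta_some (lab : Labelling b v) (i : lab.shape.Vert) :
    lab.delta (some i) = lab.delta (LabelShape.pred i) + lab.datum.root i := by
  rw [Labelling.delta]

theorem Labelling.delta_none (lab : Labelling b v) : lab.delta none = eps P := by
  rw [Labelling.delta]

theorem Labelling.seqOfChar_bijective (lab : Labelling b v) :
    Function.Bijective lab.seqOfChar := by
  obtain ⟨B, hB⟩ := lab.exists_basis
  constructor
  · intro χ₁ χ₂ h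
    let f₁ := (AddMonoidHom.toMultiplicativeLeft.symm χ₁).toIntLinearMap
    let f₂ := (AddMonoidHom.toMultiplicativeLeft.symm χ₂).toIntLinearMap
    have hδ : ∀ j, f₁ (lab.delta j) = f₂ (lab.delta j) := fun j =>
      congrArg Additive.ofMul (congrFun h j)
    have hf : f₁ = f₂ := by
      apply LinearMap.prod_ext
      · refine LinearMap.ext_ring ?_
        have := hδ none
        rw [lab.delta_none] at this
        exact this
      · apply B.ext
        intro i
        have h₁ := hδ (some i)
        rw [lab.delta_some, map_add, map_add, hδ (LabelShape.pred i)] at h₁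
        have h₂ := add_left_cancel h₁
        rw [hB]
        exact h₂
    ext x
    have := congrArg (fun f => Additive.toMul (f (Multiplicative.toAdd x))) hf
    exact congrArg Units.val this
  · intro S
    let f : ExtLattice P →+ Additive Cqˣ := AddMonoidHom.coprod
      ((zmultiplesHom (Additive Cqˣ)) (Additive.ofMul (S none)))
      (B.constr ℤ fun i =>
        Additive.ofMul (S (some i)) - Additive.ofMul (S (LabelShape.pred i))).toAddMonoidHom
    have key : ∀ n : ℕ, ∀ j : Option lab.shape.Vert, LabelShape.num j = n →
        f (lab.delta j) = Additive.ofMul (S j) := by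
      intro n
      induction n using Nat.strong_induction_on with
      | _ n ih =>
        intro j hj
        cases j with
        | none =>
          rw [lab.delta_none]
          simp [f, eps]
        | some i =>
          rw [lab.delta_some, map_add,
            ih _ (hj ▸ LabelShape.num_pred_lt i) (LabelShape.pred i) rfl]
          have hr : f (lab.datum.root i) =
              Additive.ofMul (S (some i)) - Additive.ofMul (S (LabelShape.pred i)) := by
            simp only [f, Labelling.datum, ← hB, AddMonoidHom.coprod_apply, map_zero, zero_add,
              LinearMap.toAddMonoidHom_coe, Module.Basis.constr_basis]
          rw [hr]
          abel
    refine ⟨AddMonoidHom.toMultiplicativeLeft f, ?_⟩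
    funext j
    exact congrArg Additive.toMul (key _ j rfl)

/-- The bijection between characters of `L_{R,v}` and sequences given by the basis `B_{R,v}`. -/
noncomputable def Labelling.seqEquiv (lab : Labelling b v) :
    Character (ExtLattice P) ≃ lab.Seq :=
  Equiv.ofBijective lab.seqOfChar lab.seqOfChar_bijective

/-- The set `C-Eig(B_{R,v})` of the sequences that correspond to characters in the
calibrated spectrum. -/
def Labelling.CEig (lab : Labelling b v) : Set lab.Seq := lab.seqEquiv '' CSpec lab.datum

/-- The action of the Weyl group on sequences. -/
noncomputable def Labelling.act (lab : Labelling b v) (w : ExtLattice P ≃ₗ[ℤ] ExtLattice P) (S : lab.Seq) :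
    lab.Seq := lab.seqEquiv (charAct w (lab.seqEquiv.symm S))

open Classical in
/-- The truncated operator `r̄_i` on `Seq_{R,v} ∪ {𝟎}`, with `none` standing for `𝟎`. -/
noncomputable def Labelling.truncRefl (lab : Labelling b v) (i : lab.shape.Vert) :
    Option lab.Seq → Option lab.Seq
  | none => none
  | some S =>
      if S (some i) = q ^ 2 * S (LabelShape.pred i) ∨
          S (some i) = q ^ (-2 : ℤ) * S (LabelShape.pred i) then none
      else some (lab.act (lab.datum.refl i) S)

/-- The operator `r̄_{a_1} ⋯ r̄_{a_m}`. -/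
noncomputable def Labelling.truncWord (lab : Labelling b v) (a : List lab.shape.Vert)
    (S : Option lab.Seq) : Option lab.Seq := a.foldr lab.truncRefl S

/-- The truncated orbit of `S`: all `S' ∈ Seq_{R,v}` of the form `w̄(S)` with `w` in the Weyl
group, where `w̄ = r̄_{a_1} ⋯ r̄_{a_m}` for a reduced expression `w = r_{a_1} ⋯ r_{a_m}`. -/
def Labelling.truncOrbit (lab : Labelling b v) (S : lab.Seq) : Set lab.Seq :=
  {S' | ∃ w ∈ lab.datum.weylGroup, ∃ a : List lab.shape.Vert,
    lab.datum.IsReducedExpr a w ∧ lab.truncWord a (some S) = some S'}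

end RootSystem

/-! ### Placed skew shapes and standard tableaux -/

/-- A skew diagram: the nodes of `lam` not in `mu`, translated along the diagonal. A node `(x, y)`
lies in row `x` (numbered downwards) and column `y`. -/
def IsSkewDiagram (Γ : Set (ℤ × ℤ)) : Prop :=
  ∃ (mu lam : YoungDiagram) (t : ℤ), mu ≤ lam ∧
    Γ = {p | ∃ c : ℕ × ℕ, c ∈ lam ∧ c ∉ mu ∧ p = ((c.1 : ℤ) + t, (c.2 : ℤ) + t)}

/-- A placed skew diagram of size `n` whose placed nodes are filled with the numbers
`0, …, n - 1`: the number `i` is in the node `node i` of the skew diagram at the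
place `place i`. -/
structure Filling (n : ℕ) where
  node : Fin n → ℤ × ℤ
  place : Fin n → Cqˣ
  injective : ∀ i j, node i = node j → place i = place j → i = j
  place_separated : ∀ i j, ∀ a : ℤ, place i = q ^ (2 * a) * place j → place i = place j
  skew : ∀ γ : Cqˣ, IsSkewDiagram {p | ∃ i, place i = γ ∧ node i = p}

namespace Filling

variable {n : ℕ}

/-- The classical content `y - x` of the node with number `i`. -/
def cc (F : Filling n) (i : Fin n) : ℤ := (F.node i).2 - (F.node i).1

/-- The content `γ q^{2 (y - x)}` of the placed node with number `i`. -/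
noncomputable def content (F : Filling n) (i : Fin n) : Cqˣ := F.place i * q ^ (2 * F.cc i)

/-- The numbers ascend along rows and down columns in every skew diagram. -/
def IsStandard (F : Filling n) : Prop :=
  ∀ i j, F.place i = F.place j →
    ((F.node i).1 = (F.node j).1 → (F.node i).2 < (F.node j).2 → i < j) ∧
    ((F.node i).2 = (F.node j).2 → (F.node i).1 < (F.node j).1 → i < j)

/-- The numbers `i` and `j` lie in the same connected component of one of the skew diagrams:
components are generated by lying in the same diagonal or in adjacent diagonals. -/
def SameComponent (F : Filling n) : Fin n → Fin n → Prop :=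
  Relation.EqvGen fun i j => F.place i = F.place j ∧ |F.cc i - F.cc j| ≤ 1

/-- Equivalence of fillings, the nodes being moved with their numbers in them: each place `γ` is
replaced by `γ q^{2a}` while its skew diagram moves by `a` steps to the left, and connected
components are translated along the diagonal. -/
def Equivalent (F G : Filling n) : Prop :=
  ∃ (a : Cqˣ → ℤ) (t : Fin n → ℤ), (∀ i j, F.SameComponent i j → t i = t j) ∧
    ∀ i, G.place i = F.place i * q ^ (2 * a (F.place i)) ∧
      G.node i = ((F.node i).1 + t i, (F.node i).2 - a (F.place i) + t i)

theorem content_eq_of_equivalent {F G : Filling n} (h : F.Equivalent G) (i : Fin n) :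
    F.content i = G.content i := by
  obtain ⟨a, t, -, h⟩ := h
  obtain ⟨h₁, h₂⟩ := h i
  simp only [content, cc, h₁, h₂, mul_assoc, ← zpow_add]
  congr 2
  ring

/-- The nodes with numbers `0, …, m - 1` of a standard filling. -/
def trunc (F : Filling n) (hF : F.IsStandard) (m : ℕ) (hm : m ≤ n) : Filling m where
  node i := F.node (Fin.castLE hm i)
  place i := F.place (Fin.castLE hm i)
  injective i j h₁ h₂ := Fin.castLE_injective hm (F.injective _ _ h₁ h₂)
  place_separated i j a h := F.place_separated _ _ a h
  skew γ := by
    obtain ⟨mu, lam, t, hle, hΓ⟩ := F.skew γ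
    have mem : ∀ c : ℕ × ℕ, c ∈ lam → c ∉ mu →
        ∃ i, F.place i = γ ∧ F.node i = ((c.1 : ℤ) + t, (c.2 : ℤ) + t) := by
      intro c h₁ h₂
      have : ((c.1 : ℤ) + t, (c.2 : ℤ) + t) ∈ {p | ∃ i, F.place i = γ ∧ F.node i = p} := by
        rw [hΓ]
        exact ⟨c, h₁, h₂, rfl⟩
      exact this
    let K : Set (ℕ × ℕ) := {c | ∃ i : Fin m, F.place (Fin.castLE hm i) = γ ∧
      F.node (Fin.castLE hm i) = ((c.1 : ℤ) + t, (c.2 : ℤ) + t)}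
    classical
    let lam' : YoungDiagram :=
      { cells := lam.cells.filter fun c => c ∈ mu ∨ c ∈ K
        isLowerSet := by
          rintro ⟨x, y⟩ ⟨x', y'⟩ ⟨hx, hy⟩ hc
          simp only [Finset.coe_filter, Set.mem_ofPred_eq, YoungDiagram.mem_cells] at hc ⊢
          simp only at hx hy
          obtain ⟨hl, hc⟩ := hc
          refine ⟨lam.up_left_mem hx hy hl, ?_⟩
          by_cases hmu' : (x', y') ∈ mu
          · exact Or.inl hmu'
          · have h₁ : (x, y) ∉ mu := fun h => hmu' (mu.up_left_mem hx hy h)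
            have h₂ : (x', y) ∉ mu := fun h => hmu' (mu.up_left_mem le_rfl hy h)
            have h₃ : (x', y) ∈ lam := lam.up_left_mem hx le_rfl hl
            have h₄ : (x', y') ∈ lam := lam.up_left_mem hx hy hl
            obtain ⟨i, hiγ, hi⟩ := hc.resolve_left h₁
            obtain ⟨j, hjγ, hj⟩ := mem _ h₃ h₂
            obtain ⟨k, hkγ, hk⟩ := mem _ h₄ hmu'
            have hji : j ≤ Fin.castLE hm i := by
              rcases hx.eq_or_lt with h | h
              · refine (F.injective _ _ ?_ (hjγ.trans hiγ.symm)).le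
                rw [hj, hi, h]
              · refine ((hF j _ (hjγ.trans hiγ.symm)).2 ?_ ?_).le
                · rw [hj, hi]
                · rw [hj, hi]
                  simpa using h
            have hkj : k ≤ j := by
              rcases hy.eq_or_lt with h | h
              · refine (F.injective _ _ ?_ (hkγ.trans hjγ.symm)).le
                rw [hk, hj, h]
              · refine ((hF k _ (hkγ.trans hjγ.symm)).1 ?_ ?_).le
                · rw [hk, hj]
                · rw [hk, hj]
                  simpa using h
            have hkm : (k : ℕ) < m := lt_of_le_of_lt (hkj.trans hji) i.2
            exact Or.inr ⟨⟨k, hkm⟩, hkγ, hk⟩ }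
    have hlam' : ∀ c, c ∈ lam' ↔ c ∈ lam ∧ (c ∈ mu ∨ c ∈ K) := by
      intro c
      rw [← YoungDiagram.mem_cells]
      simp [lam']
    refine ⟨mu, lam', t, ?_, ?_⟩
    · intro c hc
      exact (hlam' c).2 ⟨hle hc, Or.inl hc⟩
    · ext p
      constructor
      · rintro ⟨i, hiγ, hi⟩
        have hp : p ∈ {p | ∃ i, F.place i = γ ∧ F.node i = p} := ⟨_, hiγ, hi⟩
        rw [hΓ] at hp
        obtain ⟨c, hc₁, hc₂, hc₃⟩ := hp
        exact ⟨c, (hlam' c).2 ⟨hc₁, Or.inr ⟨i, hiγ, hi.trans hc₃⟩⟩, hc₂, hc₃⟩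
      · rintro ⟨c, hc₁, hc₂, hc₃⟩
        obtain ⟨i, hiγ, hi⟩ := ((hlam' c).1 hc₁).2.resolve_left hc₂
        exact ⟨i, hiγ, hi.trans hc₃.symm⟩

end Filling

/-- Standard fillings. -/
abbrev StdFilling (n : ℕ) : Type := {F : Filling n // F.IsStandard}

/-- The set `STab(n)` of standard tableaux of size `n`: standard fillings up to equivalence. -/
def STab (n : ℕ) : Type := Quot fun F G : StdFilling n => F.1.Equivalent G.1

/-- The content `c_i(T)`. -/
noncomputable def STab.content {n : ℕ} (T : STab n) : Fin n → Cqˣ :=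
  Quot.lift (fun F : StdFilling n => F.1.content)
    (fun _ _ h => funext fun i => Filling.content_eq_of_equivalent h i) T

/-- The standard tableau of size `m` obtained by keeping only the nodes with
numbers `0, …, m - 1`. -/
def STab.trunc {n : ℕ} (T : STab n) (m : ℕ) (hm : m ≤ n) : STab m :=
  Quot.map (fun F : StdFilling n =>
      (⟨F.1.trunc F.2 m hm, fun i j h => F.2 (Fin.castLE hm i) (Fin.castLE hm j) h⟩ : StdFilling m))
    (by
      rintro F G ⟨a, t, ht, h⟩
      refine ⟨a, fun i => t (Fin.castLE hm i), fun i j hij => ht _ _ ?_, fun i => h _⟩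
      induction hij with
      | rel i j h => exact .rel _ _ h
      | refl i => exact .refl _
      | symm i j _ ih => exact .symm _ _ ih
      | trans i j k _ _ ih₁ ih₂ => exact .trans _ _ _ ih₁ ih₂) T

/-! ### Standard tableaux of type `(R, v)` -/

/-- The set `STab(R, v)`: triples of standard tableaux of sizes `l + 1`, `l' + 1`, `l'' + 1` such
that the first two agree on the numbers `0, 1` and the first and the third agree on
the numbers `0, …, k`. -/
@[ext]
structure STabType (s : LabelShape) where
  T₁ : STab (s.l + 1)
  T₂ : STab (s.l' + 1)
  T₃ : STab (s.l'' + 1)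
  agree₂ : T₁.trunc 2 (Nat.succ_le_succ s.one_le_l) = T₂.trunc 2 (Nat.succ_le_succ s.one_le_l')
  agree₃ : T₁.trunc (s.k + 1) (Nat.succ_le_succ s.k_le_l) =
    T₃.trunc (s.k + 1) (Nat.succ_le_succ s.k_le_l'')

/-- The sequence of contents `Seq(T)`. -/
noncomputable def STabType.seq {s : LabelShape} (T : STabType s) : Option s.Vert → Cqˣ
  | none => T.T₁.content 0
  | some (.main a _ h₂) => T.T₁.content ⟨a, Nat.lt_succ_of_le h₂⟩
  | some (.und b _ h₂) => T.T₂.content ⟨b, Nat.lt_succ_of_le h₂⟩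
  | some (.dund c _ h₂) => T.T₃.content ⟨c, Nat.lt_succ_of_le h₂⟩

section Admissible

variable {ι M N : Type*} [AddCommGroup M] [Module ℝ M] [AddCommGroup N] [Module ℝ N]
variable {P : RootPairing ι ℝ M N} [P.IsCrystallographic] {b : P.Base} {v : b.support}

/-- The set `ASTab(R, v)` of admissible standard tableaux: those whose truncated orbit consists only
of sequences of contents of standard tableaux of type `(R, v)`. -/
def Labelling.ASTab (lab : Labelling b v) : Set (STabType lab.shape) :=
  {T | ∀ S ∈ lab.truncOrbit T.seq, ∃ T' : STabType lab.shape, S = T'.seq}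

end Admissible

end CalibratedHecke

/-! The link between representations and tableaux is a criterion on truncated orbits
(`Labelling.mem_CSpec_iff`): a character lies in the calibrated spectrum exactly if every sequence
`S` of its truncated orbit is regular, meaning `s_i ≠ s_{i-1}` and `s_i ≠ s_{i-2}` along the lines
of labels starting at `0`. Since `δ_i = δ_{i-1} + α_i`, this says that the corresponding character
has value `1` neither at a simple root nor at a sum of two adjacent simple roots.

Necessity: if `χ(α_i) = 1`, the commutation relation produces a Jordan block of `X^{α_i}`. Off the
walls, a suitable `g_i - a` maps a vector of weight `χ` to one of weight `r_i(χ)`, and the image can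
vanish only if `χ(α_i) = q^{±2}`. So the weights are closed under truncated reflections. If `χ(α_i +
α_j) = 1` for adjacent `i, j`, both reflected weights would lie on walls, so `g_i` and `g_j` act by
scalars, which the braid relation excludes. Sufficiency: on a regular truncated orbit, formulas as
in Young's seminormal form define a module with the orbit as a basis of weight vectors
(`CalibratedOrbit`).

Truncated orbits are defined by reduced words, while the argument adds one reflection at a time. The
two agree because a truncated word is nonzero exactly if the character avoids `q^{±2}` at the roots
attached to the word, and the roots attached to a reduced word occur, up to sign, in every word for
the same element (`mem_invs_of_reduced`).

The tableaux enter because `r_i` exchanges neighbouring entries on each line through the label `i`.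
In a family closed under the allowed exchanges, regularity forces two equal entries `s` to be
separated by both `q² s` and `q⁻² s` (`exists_between_of_swap_closed`). This is exactly what is
needed to stack equal contents along diagonals and obtain a skew diagram (`exists_filling`).
Conversely, contents of a standard tableau never agree at distance one or two. Hence the whole orbit
is regular if and only if it consists of content sequences, which is admissibility. Contents
determine a standard tableau up to equivalence (`equivalent_of_content_eq`), so the correspondence
is a bijection. -/

namespace CalibratedHecke

/-! ### Reduced words and their inversions -/

section Coxeter

variable {I T : Type*} [AddCommGroup T]

namespace SimpleRootDatum

theorem refl_apply (D : SimpleRootDatum I T) (i : I) (x : T) :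
    D.refl i x = x - D.coroot i x • D.root i := rfl

theorem refl_refl (D : SimpleRootDatum I T) (i : I) (x : T) : D.refl i (D.refl i x) = x :=
  (D.refl i).left_inv x

theorem refl_mul_self (D : SimpleRootDatum I T) (i : I) : D.refl i * D.refl i = 1 :=
  LinearEquiv.ext fun x => D.refl_refl i x

theorem refl_inv (D : SimpleRootDatum I T) (i : I) : (D.refl i)⁻¹ = D.refl i :=
  inv_eq_of_mul_eq_one_left (D.refl_mul_self i)

theorem refl_root_self (D : SimpleRootDatum I T) (i : I) : D.refl i (D.root i) = -D.root i := by
  rw [refl_apply, D.coroot_root_self]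
  module

theorem wordProd_nil (D : SimpleRootDatum I T) : D.wordProd [] = 1 := rfl

theorem wordProd_cons (D : SimpleRootDatum I T) (i : I) (a : List I) :
    D.wordProd (i :: a) = D.refl i * D.wordProd a := by
  simp [wordProd]

theorem wordProd_append (D : SimpleRootDatum I T) (a a' : List I) :
    D.wordProd (a ++ a') = D.wordProd a * D.wordProd a' := by
  simp [wordProd]

theorem wordProd_mem (D : SimpleRootDatum I T) (a : List I) : D.wordProd a ∈ D.weylGroup := by
  induction a with
  | nil => exact one_mem _
  | cons i a ih =>
    rw [wordProd_cons]
    exact mul_mem (Subgroup.subset_closure ⟨i, rfl⟩) ih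

theorem exists_reduced_of_word (D : SimpleRootDatum I T) (a : List I) :
    ∃ a', D.IsReducedExpr a' (D.wordProd a) := by
  obtain ⟨a', h, hmin⟩ := (measure (List.length (α := I))).wf.has_min
    {a' | D.wordProd a' = D.wordProd a} ⟨a, rfl⟩
  exact ⟨a', h, fun c hc => not_lt.1 (hmin c hc)⟩

theorem IsReducedExpr.tail {D : SimpleRootDatum I T} {i : I} {a : List I} {w : T ≃ₗ[ℤ] T}
    (h : D.IsReducedExpr (i :: a) w) : D.IsReducedExpr a (D.wordProd a) := by
  refine ⟨rfl, fun c hc => ?_⟩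
  have := h.2 (i :: c) (by rw [wordProd_cons, hc, ← wordProd_cons, h.1])
  simpa using this

/-- The elements `w_s⁻¹(α_i)` for the decompositions `p ++ i :: s` of a word, where `w_s` is the
product of `s`. -/
def invs (D : SimpleRootDatum I T) : List I → List T
  | [] => []
  | i :: a => (D.wordProd a)⁻¹ (D.root i) :: D.invs a

theorem length_invs (D : SimpleRootDatum I T) (a : List I) : (D.invs a).length = a.length := by
  induction a with
  | nil => rfl
  | cons i a ih => simp [invs, ih]

theorem exists_of_mem_invs (D : SimpleRootDatum I T) {a : List I} {β : T} (h : β ∈ D.invs a) :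
    ∃ p j s, a = p ++ j :: s ∧ β = (D.wordProd s)⁻¹ (D.root j) := by
  induction a with
  | nil => simp [invs] at h
  | cons i a ih =>
    rw [invs, List.mem_cons] at h
    rcases h with h | h
    · exact ⟨[], i, a, rfl, h⟩
    · obtain ⟨p, j, s, rfl, h'⟩ := ih h
      exact ⟨i :: p, j, s, rfl, h'⟩

/-- A system of positive roots for a simple root datum, together with a symmetric identification
`Λ` of roots and coroots. -/
structure PositiveSystem (D : SimpleRootDatum I T) where
  roots : Set T
  Pos : T → Prop
  Λ : T →+ T →+ ℤ
  root_mem : ∀ i, D.root i ∈ roots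
  pos_root : ∀ i, Pos (D.root i)
  refl_mem : ∀ i, ∀ x ∈ roots, D.refl i x ∈ roots
  pos_neg_iff : ∀ x ∈ roots, Pos (-x) ↔ ¬ Pos x
  pos_refl : ∀ i, ∀ x ∈ roots, Pos x → x ≠ D.root i → Pos (D.refl i x)
  Λ_root : ∀ i, Λ (D.root i) = D.coroot i
  Λ_apply_root : ∀ i, ∀ x ∈ roots, Λ x (D.root i) = D.coroot i x

namespace PositiveSystem

variable {D : SimpleRootDatum I T} (Φ : D.PositiveSystem)
include Φ

theorem wordProd_inv_mem (a : List I) {x : T} (hx : x ∈ Φ.roots) :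
    (D.wordProd a)⁻¹ x ∈ Φ.roots := by
  induction a generalizing x with
  | nil => simpa [wordProd_nil] using hx
  | cons i a ih =>
    rw [wordProd_cons, mul_inv_rev, refl_inv]
    exact ih (Φ.refl_mem i x hx)

theorem wordProd_mem_roots (a : List I) {x : T} (hx : x ∈ Φ.roots) :
    D.wordProd a x ∈ Φ.roots := by
  induction a generalizing x with
  | nil => simpa [wordProd_nil] using hx
  | cons i a ih =>
    rw [wordProd_cons]
    exact Φ.refl_mem i _ (ih hx)

theorem mem_roots_of_mem_invs {a : List I} {β : T} (h : β ∈ D.invs a) : β ∈ Φ.roots := by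
  obtain ⟨p, j, s, -, rfl⟩ := D.exists_of_mem_invs h
  exact Φ.wordProd_inv_mem s (Φ.root_mem j)

theorem pos_refl_iff (i : I) {x : T} (hx : x ∈ Φ.roots) (h₁ : x ≠ D.root i) (h₂ : x ≠ -D.root i) :
    Φ.Pos (D.refl i x) ↔ Φ.Pos x := by
  refine ⟨fun h => ?_, fun h => Φ.pos_refl i x hx h h₁⟩
  have := Φ.pos_refl i _ (Φ.refl_mem i x hx) h ?_
  · rwa [refl_refl] at this
  · intro h'
    apply h₂
    rw [← D.refl_refl i x, h', refl_root_self]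

/-- A root whose sign is changed by a product of simple reflections occurs, up to sign, among
the roots attached to the word. -/
theorem exists_mem_invs_of_sign_ne (a : List I) {β : T} (hβ : β ∈ Φ.roots)
    (h : ¬ (Φ.Pos (D.wordProd a β) ↔ Φ.Pos β)) : β ∈ D.invs a ∨ -β ∈ D.invs a := by
  induction a with
  | nil => simp [wordProd_nil] at h
  | cons i a ih =>
    by_cases h₁ : D.wordProd a β = D.root i
    · left
      rw [invs, ← h₁, ← LinearEquiv.mul_apply, inv_mul_cancel]
      simp
    by_cases h₂ : D.wordProd a β = -D.root i
    · right
      rw [invs, ← neg_neg (D.root i), ← h₂, map_neg, ← LinearEquiv.mul_apply, inv_mul_cancel]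
      simp
    rw [wordProd_cons, LinearEquiv.mul_apply,
      Φ.pos_refl_iff i (Φ.wordProd_mem_roots a hβ) h₁ h₂] at h
    rcases ih h with h | h <;> simp [invs, h]

/-- Both sides equal `Λ(y, x) - α_i^∨(y) α_i^∨(x)`. The left-hand argument has to be a root because
the symmetry `Λ_apply_root` is available only there. -/
theorem Λ_refl (i : I) {y : T} (hy : y ∈ Φ.roots) (x : T) :
    Φ.Λ (D.refl i y) x = Φ.Λ y (D.refl i x) := by
  simp only [refl_apply, map_sub, map_zsmul, AddMonoidHom.sub_apply, AddMonoidHom.smul_apply,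
    Φ.Λ_root, Φ.Λ_apply_root i y hy, smul_eq_mul]
  ring

theorem Λ_wordProd_inv (a : List I) {y : T} (hy : y ∈ Φ.roots) (x : T) :
    Φ.Λ ((D.wordProd a)⁻¹ y) x = Φ.Λ y (D.wordProd a x) := by
  induction a generalizing y with
  | nil => simp [wordProd_nil]
  | cons i a ih =>
    rw [wordProd_cons, mul_inv_rev, refl_inv, LinearEquiv.mul_apply, ih (Φ.refl_mem i y hy),
      Φ.Λ_refl i hy, LinearEquiv.mul_apply]

/-- The reflection in the root `w⁻¹(α_i)` is `w⁻¹ r_i w`. -/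
theorem wordProd_inv_refl_wordProd (a : List I) (i : I) (x : T) :
    (D.wordProd a)⁻¹ (D.refl i (D.wordProd a x)) =
      x - Φ.Λ ((D.wordProd a)⁻¹ (D.root i)) x • (D.wordProd a)⁻¹ (D.root i) := by
  rw [refl_apply, map_sub, map_zsmul, Φ.Λ_wordProd_inv a (Φ.root_mem i), Φ.Λ_root,
    ← LinearEquiv.mul_apply, inv_mul_cancel]
  rfl

/-- If the head of `invs` of a word occurs up to sign in the rest then the word can
be shortened. -/
theorem exists_shorter {i : I} {a : List I}
    (h : (D.wordProd a)⁻¹ (D.root i) ∈ D.invs a ∨ -(D.wordProd a)⁻¹ (D.root i) ∈ D.invs a) :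
    ∃ a' : List I, D.wordProd a' = D.wordProd (i :: a) ∧ a'.length < (i :: a).length := by
  have : ∃ β ∈ D.invs a, ∀ x : T, (D.wordProd a)⁻¹ (D.refl i (D.wordProd a x)) =
      x - Φ.Λ β x • β := by
    rcases h with h | h
    · exact ⟨_, h, Φ.wordProd_inv_refl_wordProd a i⟩
    · refine ⟨_, h, fun x => ?_⟩
      rw [Φ.wordProd_inv_refl_wordProd a i]
      simp
  obtain ⟨β, hβ, hx⟩ := this
  obtain ⟨p, j, s, rfl, rfl⟩ := D.exists_of_mem_invs hβ
  -- Deletion: `β` and the head define the same reflection, so with `w` the product of `p ++ j :: s`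
  -- we get `r_i w = w w_s⁻¹ r_j w_s`. The two factors `r_j` cancel, which leaves `p ++ s`.
  refine ⟨p ++ s, ?_, by simp⟩
  have key : (D.wordProd (p ++ j :: s))⁻¹ * (D.refl i * D.wordProd (p ++ j :: s)) =
      (D.wordProd s)⁻¹ * (D.refl j * D.wordProd s) := by
    ext x
    have := hx x
    rw [← Φ.wordProd_inv_refl_wordProd s j] at this
    exact this
  rw [inv_mul_eq_iff_eq_mul] at key
  rw [wordProd_cons, key, wordProd_append, wordProd_append, wordProd_cons]
  have := D.refl_mul_self j
  calc D.wordProd p * D.wordProd s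
      = D.wordProd p * (D.refl j * D.refl j) * D.wordProd s := by rw [this, mul_one]
    _ = _ := by group

/-- By reducedness the new head `w_a⁻¹(α_i)` is not, up to sign, among the earlier roots, for
otherwise the word could be shortened. Hence `w_a` preserves its sign, and it is positive since
`α_i` is. The earlier roots stay inverted because `r_i` changes only the signs of `±α_i`. -/
theorem pos_of_mem_invs {a : List I} {w : T ≃ₗ[ℤ] T} (h : D.IsReducedExpr a w) {β : T}
    (hβ : β ∈ D.invs a) : Φ.Pos β ∧ ¬ Φ.Pos (D.wordProd a β) := by
  induction a generalizing w β with
  | nil => simp [invs] at hβ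
  | cons i a ih =>
    have hnot : ¬ ((D.wordProd a)⁻¹ (D.root i) ∈ D.invs a ∨
        -(D.wordProd a)⁻¹ (D.root i) ∈ D.invs a) := fun h' => by
      obtain ⟨a', h₁, h₂⟩ := Φ.exists_shorter h'
      exact absurd (h.2 a' (h₁.trans h.1)) (not_le.2 h₂)
    have hcancel : D.wordProd a ((D.wordProd a)⁻¹ (D.root i)) = D.root i := by
      rw [← LinearEquiv.mul_apply, mul_inv_cancel]
      rfl
    have hpos : Φ.Pos ((D.wordProd a)⁻¹ (D.root i)) := by
      by_contra hneg
      refine hnot (Φ.exists_mem_invs_of_sign_ne a (Φ.wordProd_inv_mem a (Φ.root_mem i)) ?_)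
      rw [hcancel]
      exact fun hiff => hneg (hiff.1 (Φ.pos_root i))
    rw [invs, List.mem_cons] at hβ
    rcases hβ with rfl | hβ
    · refine ⟨hpos, ?_⟩
      rw [wordProd_cons, LinearEquiv.mul_apply, hcancel, refl_root_self,
        Φ.pos_neg_iff _ (Φ.root_mem i), not_not]
      exact Φ.pos_root i
    · obtain ⟨h₁, h₂⟩ := ih h.tail hβ
      refine ⟨h₁, ?_⟩
      rw [wordProd_cons, LinearEquiv.mul_apply, Φ.pos_refl_iff i
        (Φ.wordProd_mem_roots a (Φ.mem_roots_of_mem_invs hβ))]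
      · exact h₂
      · intro h'
        exact h₂ (h' ▸ Φ.pos_root i)
      · intro h'
        have : β = -(D.wordProd a)⁻¹ (D.root i) := by
          rw [← map_neg, ← h', ← LinearEquiv.mul_apply, inv_mul_cancel]
          rfl
        rw [this, Φ.pos_neg_iff _ (Φ.wordProd_inv_mem a (Φ.root_mem i))] at h₁
        exact h₁ hpos

/-- Every inversion of a reduced word occurs, up to sign, in every word with the same product. -/
theorem mem_invs_of_reduced {a a' : List I} {w : T ≃ₗ[ℤ] T} (h : D.IsReducedExpr a w)
    (h' : D.wordProd a' = w) {β : T} (hβ : β ∈ D.invs a) : β ∈ D.invs a' ∨ -β ∈ D.invs a' := by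
  obtain ⟨h₁, h₂⟩ := Φ.pos_of_mem_invs h hβ
  refine Φ.exists_mem_invs_of_sign_ne a' (Φ.mem_roots_of_mem_invs hβ) ?_
  rw [h', ← h.1]
  tauto

theorem nodup_invs {a : List I} {w : T ≃ₗ[ℤ] T} (h : D.IsReducedExpr a w) :
    (D.invs a).Nodup := by
  induction a generalizing w with
  | nil => simp [invs]
  | cons i a ih =>
    rw [invs, List.nodup_cons]
    refine ⟨fun h' => ?_, ih h.tail⟩
    obtain ⟨a', h₁, h₂⟩ := Φ.exists_shorter (.inl h')
    exact absurd (h.2 a' (h₁.trans h.1)) (not_le.2 h₂)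

/-- The roots attached to a reduced word are distinct, so its length is at most the number of roots.
This makes truncated orbits finite, hence the orbit modules finite-dimensional. -/
theorem finite_reduced [Finite I] (hfin : Φ.roots.Finite) :
    {a : List I | ∃ w, D.IsReducedExpr a w}.Finite := by
  classical
  refine (List.finite_length_le I hfin.toFinset.card).subset ?_
  rintro a ⟨w, h⟩
  rw [Set.mem_ofPred_eq, ← D.length_invs, ← List.toFinset_card_of_nodup (Φ.nodup_invs h)]
  refine Finset.card_le_card fun β hβ => ?_
  rw [List.mem_toFinset] at hβ
  exact hfin.mem_toFinset.2 (Φ.mem_roots_of_mem_invs hβ)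

end PositiveSystem

end SimpleRootDatum

end Coxeter

/-! ### Powers of the indeterminate -/

theorem q_zpow_eq_one_iff (a : ℤ) : q ^ a = 1 ↔ a = 0 := by
  have hnat : ∀ n : ℕ, q ^ n = 1 → n = 0 := by
    intro n hn
    have h : (RatFunc.X : Cq) ^ n = 1 := by
      have := congrArg Units.val hn
      simpa [q] using this
    rw [← RatFunc.algebraMap_X, ← map_pow, ← map_one (algebraMap (Polynomial ℂ) Cq)] at h
    have h' := RatFunc.algebraMap_injective ℂ h
    have := congrArg Polynomial.natDegree h'
    simpa using this
  refine ⟨fun h => ?_, fun h => by simp [h]⟩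
  obtain ⟨n, rfl | rfl⟩ := a.eq_nat_or_neg
  · simpa using hnat n (by simpa using h)
  · simpa using hnat n (by simpa using h)

theorem q_zpow_inj {a b : ℤ} : q ^ a = q ^ b ↔ a = b := by
  rw [← mul_inv_eq_one, ← zpow_sub, q_zpow_eq_one_iff, sub_eq_zero]

/-! ### Skew diagrams -/

/-- Skew diagrams are the finite order-convex subsets of `ℤ²`. Given such a set inside the quadrant
above `(t, t)`, take for `lam` all nodes of the quadrant below some node of the set and for `mu` the
nodes of `lam` outside it; convexity makes `mu` a lower set. All later arguments about shapes use
only this form. -/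
theorem isSkewDiagram_iff (Γ : Set (ℤ × ℤ)) :
    IsSkewDiagram Γ ↔ Γ.Finite ∧ ∀ p ∈ Γ, ∀ r ∈ Γ, ∀ s, p ≤ s → s ≤ r → s ∈ Γ := by
  constructor
  · rintro ⟨mu, lam, t, -, rfl⟩
    refine ⟨?_, ?_⟩
    · refine (lam.cells.finite_toSet.image
        fun c : ℕ × ℕ => ((c.1 : ℤ) + t, (c.2 : ℤ) + t)).subset ?_
      rintro p ⟨c, hc, -, rfl⟩
      exact ⟨c, hc, rfl⟩
    · rintro _ ⟨c, hc, hc', rfl⟩ _ ⟨d, hd, hd', rfl⟩ ⟨x, y⟩ ⟨h₁, h₂⟩ ⟨h₃, h₄⟩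
      simp only at h₁ h₂ h₃ h₄
      refine ⟨((x - t).toNat, (y - t).toNat), ?_, ?_, ?_⟩
      · exact lam.up_left_mem (i2 := d.1) (j2 := d.2) (by omega) (by omega) hd
      · intro h
        exact hc' (mu.up_left_mem (i1 := c.1) (j1 := c.2) (by omega) (by omega) h)
      · simp only [Prod.mk.injEq]
        omega
  · rintro ⟨hfin, hconv⟩
    obtain ⟨t, ht⟩ : ∃ t : ℤ, ∀ p ∈ Γ, t ≤ p.1 ∧ t ≤ p.2 := by
      obtain ⟨⟨t₁, t₂⟩, ht⟩ := hfin.bddBelow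
      exact ⟨min t₁ t₂, fun p hp => ⟨(min_le_left _ _).trans (ht hp).1,
        (min_le_right _ _).trans (ht hp).2⟩⟩
    let sh : ℕ × ℕ → ℤ × ℤ := fun c => ((c.1 : ℤ) + t, (c.2 : ℤ) + t)
    have hsh : Function.Injective sh := by
      rintro ⟨a, b⟩ ⟨c, d⟩ h
      simp only [sh, Prod.mk.injEq] at h ⊢
      omega
    have hmono : ∀ {c d : ℕ × ℕ}, c ≤ d → sh c ≤ sh d := by
      rintro ⟨a, b⟩ ⟨c, d⟩ ⟨h₁, h₂⟩
      simp only [sh, Prod.mk_le_mk] at h₁ h₂ ⊢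
      omega
    have hlamfin : {c : ℕ × ℕ | ∃ p ∈ Γ, sh c ≤ p}.Finite := by
      have : (⋃ p ∈ Γ, Set.Icc (t, t) p).Finite :=
        hfin.biUnion fun p _ => Set.finite_Icc _ _
      refine (this.preimage hsh.injOn).subset ?_
      rintro c ⟨p, hp, hc⟩
      simp only [Set.mem_preimage, Set.mem_iUnion]
      refine ⟨p, hp, ⟨?_, hc⟩⟩
      simp [sh, Prod.mk_le_mk]
    have hmufin : {c : ℕ × ℕ | (∃ p ∈ Γ, sh c ≤ p) ∧ sh c ∉ Γ}.Finite :=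
      hlamfin.subset fun c hc => hc.1
    let lam : YoungDiagram := ⟨hlamfin.toFinset, by
      intro d c hcd hd
      simp only [Set.Finite.coe_toFinset, Set.mem_ofPred_eq] at hd ⊢
      obtain ⟨p, hp, hd⟩ := hd
      exact ⟨p, hp, (hmono hcd).trans hd⟩⟩
    let mu : YoungDiagram := ⟨hmufin.toFinset, by
      intro d c hcd hd
      simp only [Set.Finite.coe_toFinset, Set.mem_ofPred_eq] at hd ⊢
      obtain ⟨⟨p, hp, hd⟩, hd'⟩ := hd
      exact ⟨⟨p, hp, (hmono hcd).trans hd⟩, fun hc => hd' (hconv _ hc _ hp _ (hmono hcd) hd)⟩⟩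
    have hlam : ∀ c, c ∈ lam ↔ ∃ p ∈ Γ, sh c ≤ p := fun c => by
      rw [← YoungDiagram.mem_cells]
      simp [lam]
    have hmu : ∀ c, c ∈ mu ↔ (∃ p ∈ Γ, sh c ≤ p) ∧ sh c ∉ Γ := fun c => by
      rw [← YoungDiagram.mem_cells]
      simp [mu]
    refine ⟨mu, lam, t, fun c hc => (hlam c).2 ((hmu c).1 hc).1, ?_⟩
    ext p
    constructor
    · intro hp
      have hp' : sh ((p.1 - t).toNat, (p.2 - t).toNat) = p := by
        have := ht p hp
        ext <;> simp [sh] <;> omega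
      refine ⟨((p.1 - t).toNat, (p.2 - t).toNat), (hlam _).2 ⟨p, hp, hp'.le⟩, ?_, hp'.symm⟩
      intro h
      exact ((hmu _).1 h).2 (hp'.symm ▸ hp)
    · rintro ⟨c, hc, hc', rfl⟩
      by_contra h
      exact hc' ((hmu c).2 ⟨(hlam c).1 hc, h⟩)

/-! ### Contents of standard fillings -/

namespace Filling

variable {n : ℕ}

/-- Distinct places lie in distinct cosets of `q^{2ℤ}` and `q` is not a root of unity, so a quotient
`q^{2d}` of contents forces equal places and a shift by `d` diagonals. -/
theorem content_eq_mul_iff (F : Filling n) (i j : Fin n) (d : ℤ) :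
    F.content j = q ^ (2 * d) * F.content i ↔ F.place j = F.place i ∧ F.cc j = F.cc i + d := by
  constructor
  · intro h
    have h' : F.place j = q ^ (2 * (F.cc i + d - F.cc j)) * F.place i := by
      rw [content, content] at h
      rw [eq_mul_inv_of_mul_eq h, mul_sub, mul_add, zpow_sub, zpow_add]
      simp only [mul_assoc, mul_comm, mul_left_comm]
    have hp := F.place_separated j i _ h'
    refine ⟨hp, ?_⟩
    rw [hp, eq_comm, mul_eq_right, q_zpow_eq_one_iff] at h'
    omega
  · rintro ⟨h₁, h₂⟩
    rw [content, content, h₁, h₂, mul_add, zpow_add]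
    simp only [mul_assoc, mul_comm]

theorem content_eq_iff (F : Filling n) (i j : Fin n) :
    F.content i = F.content j ↔ F.place i = F.place j ∧ F.cc i = F.cc j := by
  simpa using F.content_eq_mul_iff j i 0

theorem exists_between (F : Filling n) {i j : Fin n} (h : F.place i = F.place j) {p : ℤ × ℤ}
    (h₁ : F.node i ≤ p) (h₂ : p ≤ F.node j) : ∃ k, F.place k = F.place i ∧ F.node k = p :=
  ((isSkewDiagram_iff _).1 (F.skew (F.place i))).2 _ ⟨i, rfl, rfl⟩ _ ⟨j, h.symm, rfl⟩ p h₁ h₂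

/-- Pass through the corner in the row of `i` and the column of `j`: it belongs to the diagram by
convexity, and each leg stays in one row or one column. -/
theorem IsStandard.le_of_node_le {F : Filling n} (hF : F.IsStandard) {i j : Fin n}
    (h : F.place i = F.place j) (h' : F.node i ≤ F.node j) : i ≤ j := by
  obtain ⟨k, hk, hk'⟩ := F.exists_between h (p := ((F.node i).1, (F.node j).2))
    ⟨le_rfl, h'.2⟩ ⟨h'.1, le_rfl⟩
  have h₁ : i ≤ k := by
    rcases h'.2.eq_or_lt with h₂ | h₂
    · exact (F.injective i k (by rw [hk', ← h₂]) hk.symm).le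
    · exact ((hF i k hk.symm).1 (by rw [hk']) (by rwa [hk'])).le
  have h₂ : k ≤ j := by
    rcases h'.1.eq_or_lt with h₂ | h₂
    · exact (F.injective k j (by rw [hk', h₂]) (hk.trans h)).le
    · exact ((hF k j (hk.trans h)).2 (by rw [hk']) (by rwa [hk'])).le
  exact h₁.trans h₂

theorem IsStandard.lt_of_node_le {F : Filling n} (hF : F.IsStandard) {i j : Fin n}
    (h : F.place i = F.place j) (h' : F.node i ≤ F.node j) (hne : F.node i ≠ F.node j) : i < j :=
  (hF.le_of_node_le h h').lt_of_ne fun hij => hne (hij ▸ rfl)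

/-- The position of a node relative to the preceding node on the same diagonal or on one of the
adjacent diagonals. -/
theorem IsStandard.row_eq {F : Filling n} (hF : F.IsStandard) {m j : Fin n} (hmj : m < j)
    (hp : F.place m = F.place j) {u : ℤ}
    (hc : F.cc j = F.cc m ∧ u = 1 ∨ F.cc j = F.cc m + 1 ∧ u = 0 ∨ F.cc j = F.cc m - 1 ∧ u = 1)
    (hno : ∀ k, m < k → k < j → F.content k ≠ F.content m) :
    (F.node j).1 = (F.node m).1 + u := by
  simp only [cc] at hc
  -- If `j` were higher than claimed, its node would be weakly north-west of that of `m`, forcing `j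
  -- ≤ m`. If it were lower, the next node on the diagonal of `m` would carry a number between `m`
  -- and `j`, against `hno`.
  rcases lt_trichotomy ((F.node j).1) ((F.node m).1 + u) with h | h | h
  · have : j ≤ m := hF.le_of_node_le hp.symm ⟨by omega, by omega⟩
    exact absurd hmj (not_lt.2 this)
  · exact h
  · obtain ⟨k, hk, hk'⟩ := F.exists_between hp (p := ((F.node m).1 + 1, (F.node m).2 + 1))
      ⟨by simp, by simp⟩ ⟨by simp only; omega, by simp only; omega⟩
    have h₁ : m < k := hF.lt_of_node_le hk.symm (by rw [hk']; exact ⟨by simp, by simp⟩) (by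
      rw [hk', ne_eq, Prod.ext_iff]
      simp)
    have h₂ : k ≤ j := hF.le_of_node_le (hk.trans hp) (by
      rw [hk']
      exact ⟨by simp only; omega, by simp only; omega⟩)
    rcases h₂.eq_or_lt with rfl | h₂
    · rw [hk'] at h hc
      simp only at h hc
      omega
    · refine absurd ((F.content_eq_iff k m).2 ⟨hk, ?_⟩) (hno k h₁ h₂)
      simp [cc, hk']

/-- Two consecutive numbers have different contents. -/
theorem IsStandard.content_succ_ne {F : Filling n} (hF : F.IsStandard) {i j : Fin n}
    (hij : (j : ℕ) = i + 1) : F.content j ≠ F.content i := by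
  intro h
  obtain ⟨hp, hc⟩ := (F.content_eq_iff j i).1 h
  have hlt : i < j := Fin.lt_def.2 (by omega)
  have hr := hF.row_eq hlt hp.symm (.inl ⟨hc, rfl⟩) fun k h₁ h₂ => by
    rw [Fin.lt_def] at h₁ h₂
    omega
  simp only [cc] at hc
  -- The node of `j` is one diagonal step from that of `i`. The node to the right of `i` then lies
  -- in the diagram, and its number would be strictly between consecutive integers.
  obtain ⟨k, hk, hk'⟩ := F.exists_between hp.symm (p := ((F.node i).1, (F.node i).2 + 1))
    ⟨by simp, by simp⟩ ⟨by simp only; omega, by simp only; omega⟩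
  have h₁ : i < k := hF.lt_of_node_le hk.symm (by rw [hk']; exact ⟨by simp, by simp⟩) (by
    rw [hk', ne_eq, Prod.ext_iff]
    simp)
  have h₂ : k < j := hF.lt_of_node_le (hk.trans hp.symm)
    (by rw [hk']; exact ⟨by simp only; omega, by simp only; omega⟩) (by
      rw [hk', ne_eq, Prod.ext_iff]
      simp only
      omega)
  rw [Fin.lt_def] at h₁ h₂
  omega

/-- Two numbers with distance two have different contents. -/
theorem IsStandard.content_succ_succ_ne {F : Filling n} (hF : F.IsStandard) {i m j : Fin n}
    (him : (m : ℕ) = i + 1) (hmj : (j : ℕ) = m + 1) : F.content j ≠ F.content i := by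
  intro h
  obtain ⟨hp, hc⟩ := (F.content_eq_iff j i).1 h
  have hlt : i < j := Fin.lt_def.2 (by omega)
  have hr := hF.row_eq hlt hp.symm (.inl ⟨hc, rfl⟩) fun k h₁ h₂ => by
    rw [Fin.lt_def] at h₁ h₂
    have : k = m := Fin.ext (by omega)
    rw [this]
    exact hF.content_succ_ne him
  simp only [cc] at hc
  -- The square spanned by `i` and `j` has two further corners, but only the number `m` is available
  -- for both.
  have key : ∀ p, F.node i ≤ p → p ≤ F.node j → p ≠ F.node i → p ≠ F.node j → F.node m = p := by
    intro p h₁ h₂ h₃ h₄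
    obtain ⟨k, hk, rfl⟩ := F.exists_between hp.symm h₁ h₂
    have h₁ : i < k := hF.lt_of_node_le hk.symm h₁ (Ne.symm h₃)
    have h₂ : k < j := hF.lt_of_node_le (hk.trans hp.symm) h₂ h₄
    rw [Fin.lt_def] at h₁ h₂
    congr 1
    exact Fin.ext (by omega)
  have h₁ := key ((F.node i).1, (F.node i).2 + 1) ⟨by simp, by simp⟩
    ⟨by simp only; omega, by simp only; omega⟩ (by rw [ne_eq, Prod.ext_iff]; simp) (by
      rw [ne_eq, Prod.ext_iff]; simp only; omega)
  have h₂ := key ((F.node i).1 + 1, (F.node i).2) ⟨by simp, by simp⟩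
    ⟨by simp only; omega, by simp only; omega⟩ (by rw [ne_eq, Prod.ext_iff]; simp) (by
      rw [ne_eq, Prod.ext_iff]; simp only; omega)
  rw [h₁, Prod.mk.injEq] at h₂
  omega

/-- The relative position of two nodes on the same or adjacent diagonals is determined by
the sequence of contents. -/
theorem row_sub_eq {F G : Filling n} (hF : F.IsStandard) (hG : G.IsStandard)
    (h : ∀ i, F.content i = G.content i) {i j : Fin n} (hij : i ≤ j)
    (hp : F.place i = F.place j) (hc : |F.cc i - F.cc j| ≤ 1) :
    (G.node i).1 - (F.node i).1 = (G.node j).1 - (F.node j).1 := by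
  have htr : ∀ i j d, F.place j = F.place i ∧ F.cc j = F.cc i + d ↔
      G.place j = G.place i ∧ G.cc j = G.cc i + d := fun i j d => by
    rw [← content_eq_mul_iff, ← content_eq_mul_iff, h, h]
  induction j using WellFoundedLT.induction with
  | _ j ih =>
    rcases hij.eq_or_lt with rfl | hij
    · rfl
    -- `m` is the last number before `j` on the diagonal of `i`. By `row_eq` the row of `j` relative
    -- to `m` depends only on contents, and induction compares `m` with `i`.
    obtain ⟨m, ⟨hmi, hmj, hmc⟩, hmax⟩ : ∃ m, (i ≤ m ∧ m < j ∧ F.content m = F.content i) ∧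
        ∀ k, m < k → k < j → F.content k ≠ F.content i := by
      classical
      have hne : (Finset.univ.filter fun k => k < j ∧ F.content k = F.content i).Nonempty :=
        ⟨i, by simpa using hij⟩
      have hmem := Finset.max'_mem _ hne
      simp only [Finset.mem_filter, Finset.mem_univ, true_and] at hmem
      refine ⟨_, ⟨Finset.le_max' _ _ (by simpa using hij), hmem⟩, fun k h₁ h₂ h₃ => ?_⟩
      exact absurd (Finset.le_max' _ k (by simp [h₂, h₃])) (not_le.2 h₁)
    obtain ⟨hmp, hmcc⟩ := (F.content_eq_iff m i).1 hmc
    rw [ih m hmj hmi hmp.symm (by rw [hmcc]; simp)]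
    rw [← hmcc] at hc
    have hjm : F.place j = F.place m ∧ F.cc j = F.cc m + (F.cc j - F.cc m) :=
      ⟨by rw [← hp, hmp], by ring⟩
    obtain ⟨hGp, hGc⟩ := (htr m j _).1 hjm
    rw [abs_le] at hc
    obtain ⟨u, hu⟩ : ∃ u : ℤ, F.cc j = F.cc m ∧ u = 1 ∨ F.cc j = F.cc m + 1 ∧ u = 0 ∨
        F.cc j = F.cc m - 1 ∧ u = 1 := by
      by_cases h : F.cc j = F.cc m + 1
      · exact ⟨0, by omega⟩
      · exact ⟨1, by omega⟩
    have h₁ := hF.row_eq hmj hjm.1.symm hu fun k => by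
      rw [hmc]
      exact hmax k
    have h₂ := hG.row_eq hmj hGp.symm (u := u) (by omega) fun k => by
      rw [← h, ← h, hmc]
      exact hmax k
    omega

/-- Standard fillings with the same contents are equivalent. -/
theorem equivalent_of_content_eq {F G : Filling n} (hF : F.IsStandard) (hG : G.IsStandard)
    (h : ∀ i, F.content i = G.content i) : F.Equivalent G := by
  classical
  have htr : ∀ i j d, F.place j = F.place i ∧ F.cc j = F.cc i + d ↔
      G.place j = G.place i ∧ G.cc j = G.cc i + d := fun i j d => by
    rw [← content_eq_mul_iff, ← content_eq_mul_iff, h, h]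
  -- The shift attached to a place is the difference of classical contents at any number in it; `ha`
  -- shows independence of that number. Places that do not occur get the irrelevant value `0`.
  let a : Cqˣ → ℤ := fun γ => if hγ : ∃ i, F.place i = γ then
    F.cc hγ.choose - G.cc hγ.choose else 0
  have ha : ∀ i, a (F.place i) = F.cc i - G.cc i := by
    intro i
    have hex : ∃ j, F.place j = F.place i := ⟨i, rfl⟩
    have := ((htr i hex.choose (F.cc hex.choose - F.cc i)).1 ⟨hex.choose_spec, by ring⟩).2
    simp only [a, dif_pos hex]
    omega
  refine ⟨a, fun i => (G.node i).1 - (F.node i).1, fun i j hij => ?_, fun i => ⟨?_, ?_⟩⟩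
  · induction hij with
    | rel i j hij =>
      rcases le_total i j with hle | hle
      · exact row_sub_eq hF hG h hle hij.1 hij.2
      · exact (row_sub_eq hF hG h hle hij.1.symm (by rw [abs_sub_comm]; exact hij.2)).symm
    | refl => rfl
    | symm _ _ _ ih => exact ih.symm
    | trans _ _ _ _ _ ih₁ ih₂ => exact ih₁.trans ih₂
  · have := h i
    rw [content, content] at this
    rw [ha, eq_mul_inv_of_mul_eq this.symm, mul_sub, zpow_sub]
    simp only [mul_assoc]
  · rw [ha, Prod.ext_iff]
    simp only [cc]
    omega

end Filling

namespace STab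

variable {n : ℕ}

theorem content_injective : Function.Injective (STab.content (n := n)) := by
  intro T T' h
  induction T using Quot.ind with
  | mk F =>
    induction T' using Quot.ind with
    | mk G => exact Quot.sound (Filling.equivalent_of_content_eq F.2 G.2 fun i => congrFun h i)

theorem content_trunc (T : STab n) (m : ℕ) (hm : m ≤ n) (i : Fin m) :
    (T.trunc m hm).content i = T.content (Fin.castLE hm i) := by
  induction T using Quot.ind with
  | mk F => rfl

theorem content_succ_ne (T : STab n) {i j : Fin n} (hij : (j : ℕ) = i + 1) :
    T.content j ≠ T.content i := by
  induction T using Quot.ind with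
  | mk F => exact F.2.content_succ_ne hij

theorem content_succ_succ_ne (T : STab n) {i m j : Fin n} (him : (m : ℕ) = i + 1)
    (hmj : (j : ℕ) = m + 1) : T.content j ≠ T.content i := by
  induction T using Quot.ind with
  | mk F => exact F.2.content_succ_succ_ne him hmj

end STab

/-! ### Sequences with interlacing values -/

section Count

variable {α : Type*} [DecidableEq α]

/-- If the occurrences of two values in a sequence alternate then the numbers of
their occurrences differ by at most one, with a sign depending on which value occurs first. -/
theorem count_sub_count_of_alternating (f : ℕ → α) (n : ℕ) {s s' : α} (hs : s ≠ s')
    (h : ∀ i j, i < j → j < n → f i = s → f j = s → ∃ k, i < k ∧ k < j ∧ f k = s')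
    (h' : ∀ i j, i < j → j < n → f i = s' → f j = s' → ∃ k, i < k ∧ k < j ∧ f k = s)
    {e : ℤ} (he : (e = 1 ∧ ∃ j < n, f j = s' ∧ ∀ i < j, f i ≠ s) ∨
      (e = 0 ∧ ¬ ∃ j < n, f j = s' ∧ ∀ i < j, f i ≠ s)) {m : ℕ} (hm : m ≤ n) :
    (Nat.count (f · = s') m : ℤ) - Nat.count (f · = s) m = e ∨
      (Nat.count (f · = s') m : ℤ) - Nat.count (f · = s) m = e - 1 := by
  -- The invariant must remember which of the two values occurred last: before any occurrence the
  -- difference is `0`, after an `s'` it is `e`, after an `s` it is `e - 1`.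
  suffices H : ((∀ i < m, f i ≠ s ∧ f i ≠ s') ∧
        (Nat.count (f · = s') m : ℤ) - Nat.count (f · = s) m = 0) ∨
      ((∃ i < m, f i = s' ∧ ∀ k, i < k → k < m → f k ≠ s) ∧
        (Nat.count (f · = s') m : ℤ) - Nat.count (f · = s) m = e) ∨
      ((∃ i < m, f i = s ∧ ∀ k, i < k → k < m → f k ≠ s') ∧
        (Nat.count (f · = s') m : ℤ) - Nat.count (f · = s) m = e - 1) by
    rcases he with ⟨rfl, -⟩ | ⟨rfl, -⟩ <;> rcases H with H | H | H <;> simp [H.2]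
  induction m with
  | zero => left; simp
  | succ m ih =>
    have ih := ih (by omega)
    simp only [Nat.count_succ]
    by_cases h₁ : f m = s'
    · have h₂ : f m ≠ s := h₁ ▸ hs.symm
      simp only [h₁, if_true, hs.symm, if_false]
      right; left
      refine ⟨⟨m, by omega, h₁, fun k _ _ => by omega⟩, ?_⟩
      rcases ih with ⟨hno, hD⟩ | ⟨⟨i, him, hi, hno⟩, hD⟩ | ⟨-, hD⟩
      · rcases he with ⟨rfl, -⟩ | ⟨-, hex⟩
        · push_cast; omega
        · exact absurd ⟨m, by omega, h₁, fun i hi => (hno i hi).1⟩ hex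
      · obtain ⟨k, hk₁, hk₂, hk⟩ := h' i m him (by omega) hi h₁
        exact absurd hk (hno k hk₁ hk₂)
      · push_cast; omega
    · by_cases h₂ : f m = s
      · simp only [h₂, if_true, hs, if_false]
        right; right
        refine ⟨⟨m, by omega, h₂, fun k _ _ => by omega⟩, ?_⟩
        rcases ih with ⟨hno, hD⟩ | ⟨-, hD⟩ | ⟨⟨i, him, hi, hno⟩, hD⟩
        · rcases he with ⟨-, j, hj, hj', hjs⟩ | ⟨rfl, -⟩
          · rcases lt_trichotomy j m with hjm | rfl | hjm
            · exact absurd hj' (hno j hjm).2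
            · exact absurd hj' h₁
            · exact absurd h₂ (hjs m hjm)
          · push_cast; omega
        · push_cast; omega
        · obtain ⟨k, hk₁, hk₂, hk⟩ := h i m him (by omega) hi h₂
          exact absurd hk (hno k hk₁ hk₂)
      · simp only [h₁, h₂, if_false, add_zero]
        rcases ih with ⟨hno, hD⟩ | ⟨⟨i, him, hi, hno⟩, hD⟩ | ⟨⟨i, him, hi, hno⟩, hD⟩
        · refine .inl ⟨fun i hi => ?_, hD⟩
          rcases Nat.lt_succ_iff_lt_or_eq.1 hi with hi | rfl
          · exact hno i hi
          · exact ⟨h₂, h₁⟩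
        · refine .inr (.inl ⟨⟨i, by omega, hi, fun k hk hk' => ?_⟩, hD⟩)
          rcases Nat.lt_succ_iff_lt_or_eq.1 hk' with hk' | rfl
          · exact hno k hk hk'
          · exact h₂
        · refine .inr (.inr ⟨⟨i, by omega, hi, fun k hk hk' => ?_⟩, hD⟩)
          rcases Nat.lt_succ_iff_lt_or_eq.1 hk' with hk' | rfl
          · exact hno k hk hk'
          · exact h₁

theorem exists_count_eq (p : ℕ → Prop) [DecidablePred p] {n k : ℕ} (h : k < Nat.count p n) :
    ∃ i < n, p i ∧ Nat.count p i = k := by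
  induction n with
  | zero => simp at h
  | succ n ih =>
    rw [Nat.count_succ] at h
    by_cases hk : k < Nat.count p n
    · obtain ⟨i, hi, hi'⟩ := ih hk
      exact ⟨i, by omega, hi'⟩
    · split_ifs at h with hp
      · exact ⟨n, by omega, hp, by omega⟩
      · omega

end Count

/-- A family of sequences that is closed under exchanging neighbouring entries whose quotient
is not `q^{±2}`, and in which entries at distance one or two are different: then two equal
entries `s` are separated by `q² s` and by `q⁻² s`. -/
theorem exists_between_of_swap_closed {σ : Type*} (ev : σ → ℕ → Cqˣ) (N : ℕ)
    (h₁ : ∀ S a, a + 1 ≤ N → ev S a ≠ ev S (a + 1))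
    (h₂ : ∀ S a, a + 2 ≤ N → ev S a ≠ ev S (a + 2))
    (hswap : ∀ S a, a + 1 ≤ N → ev S (a + 1) ≠ q ^ (2 : ℤ) * ev S a →
      ev S (a + 1) ≠ q ^ (-2 : ℤ) * ev S a → ∃ S', ev S' a = ev S (a + 1) ∧
        ev S' (a + 1) = ev S a ∧ ∀ b ≤ N, b ≠ a → b ≠ a + 1 → ev S' b = ev S b)
    (S : σ) {i j : ℕ} (hij : i < j) (hj : j ≤ N) (h : ev S i = ev S j)
    {u : ℤ} (hu : u = 2 ∨ u = -2) : ∃ k, i < k ∧ k < j ∧ ev S k = q ^ u * ev S i := by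
  induction hd : j - i using Nat.strong_induction_on generalizing S i j u with
  | _ d ih =>
    have hi₁ : i + 1 < j := by
      rcases Nat.lt_or_ge (i + 1) j with h' | h'
      · exact h'
      · have : j = i + 1 := by omega
        exact absurd (this ▸ h) (h₁ S i (by omega))
    -- If the entry after `i` is not `q^{±2}` times the repeated value, an exchange moves that value
    -- inwards and shortens the interval. The same is done below at the right end.
    by_cases hl : ev S (i + 1) ≠ q ^ (2 : ℤ) * ev S i ∧ ev S (i + 1) ≠ q ^ (-2 : ℤ) * ev S i
    · obtain ⟨S', h₃, h₄, h₅⟩ := hswap S i (by omega) hl.1 hl.2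
      obtain ⟨k, hk₁, hk₂, hk⟩ := ih (j - (i + 1)) (by omega) S' hi₁ hj
        (by rw [h₄, h₅ j hj (by omega) (by omega), h]) hu rfl
      refine ⟨k, by omega, hk₂, ?_⟩
      rw [← h₅ k (by omega) (by omega) (by omega), hk, h₄]
    obtain ⟨j, rfl⟩ : ∃ j', j = j' + 1 := ⟨j - 1, by omega⟩
    by_cases hr : ev S j ≠ q ^ (2 : ℤ) * ev S i ∧ ev S j ≠ q ^ (-2 : ℤ) * ev S i
    · obtain ⟨S', h₃, h₄, h₅⟩ := hswap S j (by omega)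
        (fun h' => hr.2 (by rw [h, h', ← mul_assoc, ← zpow_add]; simp))
        (fun h' => hr.1 (by rw [h, h', ← mul_assoc, ← zpow_add]; simp))
      have hi' := h₅ i (by omega) (by omega) (by omega)
      obtain ⟨k, hk₁, hk₂, hk⟩ := ih (j - i) (by omega) S' (i := i) (j := j) (by omega) (by omega)
        (by rw [h₃, hi', h]) hu rfl
      refine ⟨k, hk₁, by omega, ?_⟩
      rw [← h₅ k (by omega) (by omega) (by omega), hk, hi']
    by_cases hlu : ev S (i + 1) = q ^ u * ev S i
    · exact ⟨i + 1, by omega, hi₁, hlu⟩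
    by_cases hru : ev S j = q ^ u * ev S i
    · exact ⟨j, by omega, by omega, hru⟩
    -- In the remaining case both inner neighbours equal `q^{-u} s`. They are different positions,
    -- as equal values at distance two are excluded. Induction between them yields `q^u q^{-u} s =
    -- s` at some `m`, and induction between `i` and `m` yields `q^u s`.
    have hl' : ev S (i + 1) = q ^ (-u) * ev S i := by
      rcases hu with rfl | rfl
      · tauto
      · rw [neg_neg]
        tauto
    have hr' : ev S j = q ^ (-u) * ev S i := by
      rcases hu with rfl | rfl
      · tauto
      · rw [neg_neg]
        tauto
    have hij' : i + 1 < j := by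
      rcases lt_trichotomy (i + 1) j with h' | h' | h'
      · exact h'
      · subst h'
        exact absurd h (h₂ S i (by omega))
      · omega
    obtain ⟨m, hm₁, hm₂, hm⟩ := ih (j - (i + 1)) (by omega) S hij' (by omega) (hl'.trans hr'.symm)
      hu rfl
    rw [hl', ← mul_assoc, ← zpow_add, add_neg_cancel, zpow_zero, one_mul] at hm
    obtain ⟨k, hk₁, hk₂, hk⟩ := ih (m - i) (by omega) S (i := i) (j := m) (by omega) (by omega)
      hm.symm hu rfl
    exact ⟨k, hk₁, by omega, hk⟩

/-! ### Existence of standard fillings -/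

/-- A discrete antiderivative on all of `ℤ`, normalized to vanish at `0`. It provides the starting
rows of the diagonals from their prescribed differences. -/
theorem exists_int_potential (e : ℤ → ℤ) : ∃ X : ℤ → ℤ, ∀ c, X (c + 1) = X c - e c := by
  refine ⟨fun c => (∑ d ∈ Finset.Ico c 0, e d) - ∑ d ∈ Finset.Ico 0 c, e d, fun c => ?_⟩
  rcases lt_or_ge c 0 with h | h
  · have h' : Finset.Ico c 0 = insert c (Finset.Ico (c + 1) 0) := by
      ext; simp only [Finset.mem_Ico, Finset.mem_insert]; omega
    have h₁ : Finset.Ico 0 c = ∅ := Finset.Ico_eq_empty (by omega)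
    have h₂ : Finset.Ico 0 (c + 1) = ∅ := Finset.Ico_eq_empty (by omega)
    simp only [h₁, h₂, h', Finset.sum_empty]
    rw [Finset.sum_insert (by simp)]
    ring
  · have h' : Finset.Ico 0 (c + 1) = insert c (Finset.Ico 0 c) := by
      ext; simp only [Finset.mem_Ico, Finset.mem_insert]; omega
    have h₁ : Finset.Ico c 0 = ∅ := Finset.Ico_eq_empty (by omega)
    have h₂ : Finset.Ico (c + 1) 0 = ∅ := Finset.Ico_eq_empty (by omega)
    simp only [h₁, h₂, h', Finset.sum_empty]
    rw [Finset.sum_insert (by simp)]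
    ring

/-- A system of representatives `place` of the cosets of `q^{2ℤ}`, with the exponents `diag`. -/
theorem exists_place_diag : ∃ (place : Cqˣ → Cqˣ) (diag : Cqˣ → ℤ),
    (∀ s, s = place s * q ^ (2 * diag s)) ∧
    (∀ s (a : ℤ), place (s * q ^ (2 * a)) = place s) := by
  let place : Cqˣ → Cqˣ := fun s => (QuotientGroup.mk s : Cqˣ ⧸ Subgroup.zpowers (q ^ 2)).out
  have h : ∀ s, ∃ d : ℤ, s = place s * q ^ (2 * d) := by
    intro s
    have : (place s)⁻¹ * s ∈ Subgroup.zpowers (q ^ 2) :=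
      QuotientGroup.eq.1 (Quotient.out_eq _)
    obtain ⟨d, hd⟩ := Subgroup.mem_zpowers_iff.1 this
    refine ⟨d, ?_⟩
    rw [zpow_mul]
    simpa using (eq_mul_of_inv_mul_eq hd.symm)
  choose diag hdiag using h
  refine ⟨place, diag, hdiag, fun s a => ?_⟩
  have : (QuotientGroup.mk (s * q ^ (2 * a)) : Cqˣ ⧸ Subgroup.zpowers (q ^ 2)) =
      QuotientGroup.mk s := by
    refine (QuotientGroup.eq.2 ?_).symm
    rw [inv_mul_cancel_left, zpow_mul]
    exact Subgroup.mem_zpowers_iff.2 ⟨a, by simp⟩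
  simp only [place, this]

/-- Integer functions whose increments are `0` or `-1`. -/
theorem staircase_bounds {h : ℤ → ℤ} (hh : ∀ c, h (c + 1) = h c ∨ h (c + 1) = h c - 1) {c c' : ℤ}
    (hc : c ≤ c') : h c' ≤ h c ∧ h c ≤ h c' + (c' - c) := by
  induction c', hc using Int.leInduction with
  | base => simp
  | succ c' hc ih => rcases hh c' with h' | h' <;> omega

/-- A sequence in which equal entries `s` are separated by `q² s` and by `q⁻² s` is the sequence of
contents of a standard filling. -/
theorem exists_filling (f : ℕ → Cqˣ) (n : ℕ)
    (hf : ∀ i j, i < j → j < n → f i = f j → ∀ u : ℤ, u = 2 ∨ u = -2 →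
      ∃ k, i < k ∧ k < j ∧ f k = q ^ u * f i) :
    ∃ F : Filling n, F.IsStandard ∧ ∀ i : Fin n, F.content i = f i := by
  classical
  obtain ⟨place, diag, hpd, hplace⟩ := exists_place_diag
  have hdiag : ∀ s (a : ℤ), diag (s * q ^ (2 * a)) = diag s + a := by
    intro s a
    have h₁ := hpd (s * q ^ (2 * a))
    rw [hplace] at h₁
    nth_rw 1 [hpd s] at h₁
    rw [mul_assoc, ← zpow_add, mul_right_inj, q_zpow_inj] at h₁
    omega
  -- `e s = 1` if `q² s` occurs before every `s`; the diagonal of `q² s` must then start one row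
  -- higher than that of `s`, and otherwise in the same row.
  let e : Cqˣ → ℤ := fun s => if ∃ j < n, f j = s * q ^ (2 : ℤ) ∧ ∀ i < j, f i ≠ s then 1 else 0
  choose X hX using fun γ : Cqˣ => exists_int_potential fun c => e (γ * q ^ (2 * c))
  -- The row of the first node on the diagonal with content `s`; each further occurrence of `s` goes
  -- one step down that diagonal.
  let ξ : Cqˣ → ℤ := fun s => X (place s) (diag s)
  have hξ : ∀ s, ξ (s * q ^ (2 : ℤ)) = ξ s - e s := by
    intro s
    have h₁ := hplace s 1
    have h₂ := hdiag s 1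
    rw [mul_one] at h₁ h₂
    simp only [ξ]
    rw [h₁, h₂, hX, ← hpd]
  let cnt : Cqˣ → ℕ → ℕ := fun s m => Nat.count (f · = s) m
  -- Equal entries being separated on both sides means that `s` and `q² s` alternate, so `ξ + cnt`
  -- also has increments `0` or `-1` at every time `m`.
  have hcnt : ∀ s, ∀ m ≤ n, (cnt (s * q ^ (2 : ℤ)) m : ℤ) - cnt s m = e s ∨
      (cnt (s * q ^ (2 : ℤ)) m : ℤ) - cnt s m = e s - 1 := by
    intro s m hm
    refine count_sub_count_of_alternating f n ?_ ?_ ?_ ?_ hm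
    · rw [ne_eq, eq_comm, mul_eq_left, q_zpow_eq_one_iff]
      decide
    · intro i j hij hj hi hj'
      obtain ⟨k, h₁, h₂, h₃⟩ := hf i j hij hj (hi.trans hj'.symm) 2 (.inl rfl)
      exact ⟨k, h₁, h₂, by rw [h₃, hi, mul_comm]⟩
    · intro i j hij hj hi hj'
      obtain ⟨k, h₁, h₂, h₃⟩ := hf i j hij hj (hi.trans hj'.symm) (-2) (.inr rfl)
      exact ⟨k, h₁, h₂, by rw [h₃, hi, mul_comm, mul_assoc, ← zpow_add]; simp⟩
    · by_cases h : ∃ j < n, f j = s * q ^ (2 : ℤ) ∧ ∀ i < j, f i ≠ s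
      · exact .inl ⟨if_pos h, h⟩
      · exact .inr ⟨if_neg h, h⟩
  have he : ∀ s, e s = 0 ∨ e s = 1 := by
    intro s
    by_cases h : ∃ j < n, f j = s * q ^ (2 : ℤ) ∧ ∀ i < j, f i ≠ s
    · exact .inr (if_pos h)
    · exact .inl (if_neg h)
  have hstep : ∀ (γ : Cqˣ) (c : ℤ), γ * q ^ (2 * (c + 1)) = γ * q ^ (2 * c) * q ^ (2 : ℤ) := by
    intro γ c
    rw [mul_assoc, ← zpow_add]
    ring_nf
  -- the inner boundary and, at every time, the outer boundary of the diagram are staircases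
  have inner : ∀ (γ : Cqˣ) (p p' : ℤ × ℤ), p ≤ p' → ξ (γ * q ^ (2 * (p.2 - p.1))) ≤ p.1 →
      ξ (γ * q ^ (2 * (p'.2 - p'.1))) ≤ p'.1 := by
    rintro γ ⟨x, y⟩ ⟨x', y'⟩ ⟨h₁, h₂⟩ h₃
    simp only at h₁ h₂ h₃ ⊢
    have hh : ∀ c : ℤ, ξ (γ * q ^ (2 * (c + 1))) = ξ (γ * q ^ (2 * c)) ∨
        ξ (γ * q ^ (2 * (c + 1))) = ξ (γ * q ^ (2 * c)) - 1 := by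
      intro c
      rw [hstep, hξ]
      rcases he (γ * q ^ (2 * c)) with h | h <;> rw [h] <;> simp
    rcases le_total (y - x) (y' - x') with h | h
    · have := staircase_bounds (h := fun c => ξ (γ * q ^ (2 * c))) hh h
      omega
    · have := staircase_bounds (h := fun c => ξ (γ * q ^ (2 * c))) hh h
      omega
  have outer : ∀ m ≤ n, ∀ (γ : Cqˣ) (p p' : ℤ × ℤ), p ≤ p' →
      p'.1 < ξ (γ * q ^ (2 * (p'.2 - p'.1))) + cnt (γ * q ^ (2 * (p'.2 - p'.1))) m →
      p.1 < ξ (γ * q ^ (2 * (p.2 - p.1))) + cnt (γ * q ^ (2 * (p.2 - p.1))) m := by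
    rintro m hm γ ⟨x, y⟩ ⟨x', y'⟩ ⟨h₁, h₂⟩ h₃
    simp only at h₁ h₂ h₃ ⊢
    let Z : ℤ → ℤ := fun c => ξ (γ * q ^ (2 * c)) + cnt (γ * q ^ (2 * c)) m
    have hh : ∀ c : ℤ, Z (c + 1) = Z c ∨ Z (c + 1) = Z c - 1 := by
      intro c
      simp only [Z]
      rw [hstep, hξ]
      rcases hcnt (γ * q ^ (2 * c)) m hm with h | h <;> omega
    rcases le_total (y - x) (y' - x') with h | h
    · have := staircase_bounds hh h
      simp only [Z] at this
      omega
    · have := staircase_bounds hh h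
      simp only [Z] at this
      omega
  let node : ℕ → ℤ × ℤ := fun i =>
    (ξ (f i) + cnt (f i) i, ξ (f i) + cnt (f i) i + diag (f i))
  have hval : ∀ i, f i = place (f i) * q ^ (2 * ((node i).2 - (node i).1)) := by
    intro i
    simp only [node, add_sub_cancel_left]
    exact hpd (f i)
  -- If `j < i`, the node of `i` would already lie inside the outer boundary at time `j + 1`,
  -- although its height on the diagonal counts all occurrences of `f i` before `i`.
  have hle : ∀ i j : ℕ, j < n → place (f i) = place (f j) → node i ≤ node j → i ≤ j := by
    intro i j hj hp hle
    by_contra hlt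
    have h₁ := outer (j + 1) (by omega) (place (f j)) _ _ hle (by
      rw [← hval]
      simp only [node, cnt, Nat.count_succ]
      simp)
    rw [← hp, ← hval] at h₁
    have h₂ : cnt (f i) (j + 1) ≤ cnt (f i) i := Nat.count_monotone _ (by omega)
    simp only [node] at h₁
    omega
  refine ⟨⟨fun i => node i, fun i => place (f i), ?_, ?_, ?_⟩, ?_, ?_⟩
  · intro i j h₁ h₂
    exact le_antisymm (hle i j j.2 h₂ h₁.le) (hle j i i.2 h₂.symm h₁.ge)
  · intro i j a h
    have h₁ : place (place (f i)) = place (f i) := by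
      conv_rhs => rw [hpd (f i), hplace]
    have h₂ : place (place (f j)) = place (f j) := by
      conv_rhs => rw [hpd (f j), hplace]
    rw [← h₁, h, mul_comm, hplace, h₂]
  · intro γ
    rw [isSkewDiagram_iff]
    have hmem : ∀ i : Fin n, place (f i) = γ →
        ξ (γ * q ^ (2 * ((node i).2 - (node i).1))) ≤ (node i).1 ∧
        (node i).1 < ξ (γ * q ^ (2 * ((node i).2 - (node i).1))) +
          cnt (γ * q ^ (2 * ((node i).2 - (node i).1))) n := by
      rintro i rfl
      rw [← hval]
      have : cnt (f i) i < cnt (f i) n := Nat.count_strict_mono rfl i.2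
      simp only [node]
      omega
    refine ⟨?_, ?_⟩
    · exact (Set.finite_range fun i : Fin n => node i).subset fun p ⟨i, _, hi⟩ => ⟨i, hi⟩
    · rintro _ ⟨i, hi, rfl⟩ _ ⟨j, hj, rfl⟩ p hip hpj
      have h₁ := inner γ _ _ hip (hmem i hi).1
      have h₂ := outer n le_rfl γ _ _ hpj (hmem j hj).2
      -- The number to be found in `p` is the occurrence of its content preceded by as many equal
      -- entries as `p` is below the inner boundary.
      obtain ⟨k, hk, hfk, hck⟩ := exists_count_eq (f · = γ * q ^ (2 * (p.2 - p.1))) (n := n)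
        (k := (p.1 - ξ (γ * q ^ (2 * (p.2 - p.1)))).toNat) (by simp only [cnt] at h₂; omega)
      have hγ : place γ = γ := by
        rw [← hi]
        conv_rhs => rw [hpd (f i), hplace]
      have hdγ : diag γ = 0 := by
        have := hpd γ
        rw [hγ, eq_comm, mul_eq_left, q_zpow_eq_one_iff] at this
        omega
      refine ⟨⟨k, hk⟩, ?_, ?_⟩
      · simp only
        rw [hfk, hplace, hγ]
      · simp only [node, cnt]
        rw [hfk, hck, hdiag, hdγ, Prod.ext_iff]
        simp only
        omega
  · intro i j hp
    simp only at hp ⊢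
    refine ⟨fun h₁ h₂ => ?_, fun h₁ h₂ => ?_⟩
    · refine lt_of_le_of_ne (hle i j j.2 hp ⟨h₁.le, h₂.le⟩) ?_
      rintro rfl
      exact h₂.ne rfl
    · refine lt_of_le_of_ne (hle i j j.2 hp ⟨h₂.le, h₁.le⟩) ?_
      rintro rfl
      exact h₂.ne rfl
  · intro i
    exact (hval i).symm

/-! ### Representations of the affine Hecke algebra over `ℂ(q)` -/

theorem map_altProd {A B F : Type*} [Monoid A] [Monoid B] [FunLike F A B] [MonoidHomClass F A B]
    (f : F) (m : ℕ) (x y : A) : f (altProd m x y) = altProd m (f x) (f y) := by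
  induction m generalizing x y with
  | zero => simp [altProd]
  | succ m ih => simp [altProd, ih]

theorem algebraMap_qq : algebraMap ℂ[T;T⁻¹] Cq qq = (q : Cq) - (q : Cq)⁻¹ := by
  have : algebraMap ℂ[T;T⁻¹] Cq = LaurentPolynomial.eval₂ (algebraMap ℂ Cq) q := rfl
  rw [this, qq, map_sub, LaurentPolynomial.eval₂_T, LaurentPolynomial.eval₂_T]
  simp

theorem q_sub_inv_ne_zero : (q : Cq) - (q : Cq)⁻¹ ≠ 0 := by
  intro h
  have h₁ : (q : Cqˣ) = q⁻¹ := Units.ext (by simpa [sub_eq_zero] using h)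
  have h₂ : q ^ (1 : ℤ) = q ^ (-1 : ℤ) := by simpa using h₁
  exact absurd (q_zpow_inj.1 h₂) (by decide)

section Relations

variable {I T : Type*} [AddCommGroup T] (D : SimpleRootDatum I T)

/-- The element `g_i` of `ℂ(q) H(R, T)`. -/
noncomputable def cqG (i : I) : CqHecke D :=
  1 ⊗ₜ RingQuot.mkAlgHom ℂ[T;T⁻¹] (HeckeRel D) (fg T i)

/-- The canonical map from the free algebra to `ℂ(q) H(R, T)`. -/
noncomputable def freeToCq : FreeHecke I T →ₐ[ℂ[T;T⁻¹]] CqHecke D :=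
  Algebra.TensorProduct.includeRight.comp (RingQuot.mkAlgHom ℂ[T;T⁻¹] (HeckeRel D))

theorem freeToCq_fX (x : T) : freeToCq D (fX I x) = cqX D x := rfl

theorem freeToCq_fg (i : I) : freeToCq D (fg T i) = cqG D i := rfl

theorem freeToCq_eq {u v : FreeHecke I T} (h : HeckeRel D u v) : freeToCq D u = freeToCq D v := by
  simp only [freeToCq, AlgHom.comp_apply]
  rw [RingQuot.mkAlgHom_rel _ h]

theorem qq_smul (z : CqHecke D) : qq • z = ((q : Cq) - (q : Cq)⁻¹) • z := by
  rw [← algebraMap_qq, algebraMap_smul]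

theorem cqG_quadratic (i : I) :
    cqG D i * cqG D i = ((q : Cq) - (q : Cq)⁻¹) • cqG D i + 1 := by
  simpa [freeToCq_fg, qq_smul] using freeToCq_eq D (HeckeRel.quadratic i)

theorem cqG_braid {i j : I} (hij : i ≠ j) :
    altProd (orderOf (D.refl i * D.refl j)) (cqG D i) (cqG D j) =
      altProd (orderOf (D.refl i * D.refl j)) (cqG D j) (cqG D i) := by
  simpa [map_altProd, freeToCq_fg] using freeToCq_eq D (HeckeRel.braid i j hij)

theorem cqG_lusztig (i : I) (x : T) :
    cqG D i * cqX D x - cqX D (D.refl i x) * cqG D i = ((q : Cq) - (q : Cq)⁻¹) •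
      ((∑ k ∈ Finset.range (D.coroot i x).toNat, cqX D (x - k • D.root i)) -
        ∑ k ∈ Finset.range (-D.coroot i x).toNat, cqX D (D.refl i x - k • D.root i)) := by
  simpa [freeToCq_fg, freeToCq_fX, qq_smul, lusztigQuotient] using
    freeToCq_eq D (HeckeRel.lusztig i x)

/-- The universal property of `ℂ(q) H(R, T)`. -/
theorem exists_algHom {A : Type*} [Ring A] [Algebra Cq A] (g : I → A) (X : T → A)
    (hX₀ : X 0 = 1) (hX : ∀ x y, X (x + y) = X x * X y)
    (hquad : ∀ i, g i * g i = ((q : Cq) - (q : Cq)⁻¹) • g i + 1)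
    (hbraid : ∀ i j, i ≠ j → altProd (orderOf (D.refl i * D.refl j)) (g i) (g j) =
      altProd (orderOf (D.refl i * D.refl j)) (g j) (g i))
    (hlus : ∀ i x, g i * X x - X (D.refl i x) * g i = ((q : Cq) - (q : Cq)⁻¹) •
      ((∑ k ∈ Finset.range (D.coroot i x).toNat, X (x - k • D.root i)) -
        ∑ k ∈ Finset.range (-D.coroot i x).toNat, X (D.refl i x - k • D.root i))) :
    ∃ ρ : CqHecke D →ₐ[Cq] A, ∀ x, ρ (cqX D x) = X x := by
  let _ : Algebra ℂ[T;T⁻¹] A := Algebra.compHom A (algebraMap ℂ[T;T⁻¹] Cq)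
  have _ : IsScalarTower ℂ[T;T⁻¹] Cq A := IsScalarTower.of_algebraMap_eq fun _ => rfl
  have hqq : ∀ z : A, qq • z = ((q : Cq) - (q : Cq)⁻¹) • z := fun z => by
    rw [← algebraMap_qq, algebraMap_smul]
  let φ : FreeHecke I T →ₐ[ℂ[T;T⁻¹]] A := FreeAlgebra.lift _ fun
    | .g i => g i
    | .X x => X x
  have hφg : ∀ i, φ (fg T i) = g i := fun i => by simp [φ, fg]
  have hφX : ∀ x, φ (fX I x) = X x := fun x => by simp [φ, fX]
  have hφ : ∀ ⦃u v⦄, HeckeRel D u v → φ u = φ v := by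
    intro u v h
    cases h with
    | X_zero => simpa [hφX] using hX₀
    | X_add x y => simpa [hφX] using (hX x y).symm
    | quadratic i => simpa [hφg, hqq] using hquad i
    | braid i j hij => simpa [map_altProd, hφg] using hbraid i j hij
    | lusztig i x => simpa [hφg, hφX, hqq, lusztigQuotient] using hlus i x
  let ψ : AffineHecke D →ₐ[ℂ[T;T⁻¹]] A := RingQuot.liftAlgHom ℂ[T;T⁻¹] ⟨φ, hφ⟩
  refine ⟨Algebra.TensorProduct.lift (Algebra.ofId Cq A) ψ
    fun s z => Algebra.commute_algebraMap_left s (ψ z), fun x => ?_⟩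
  refine (Algebra.TensorProduct.lift_tmul _ _ _ _ _).trans ?_
  rw [map_one, one_mul, heckeX]
  exact (RingQuot.liftAlgHom_mkAlgHom_apply ..).trans (hφX x)

end Relations

/-! ### Values of characters -/

section Characters

variable {I T : Type*} [AddCommGroup T] (D : SimpleRootDatum I T)

/-- The value of a character at an element of the lattice. -/
noncomputable def cval (χ : Character T) (x : T) : Cq := (χ (Multiplicative.ofAdd x) : Cq)

theorem cval_zero (χ : Character T) : cval χ 0 = 1 := by simp [cval]

theorem cval_add (χ : Character T) (x y : T) : cval χ (x + y) = cval χ x * cval χ y := by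
  simp [cval, ofAdd_add]

theorem cval_ne_zero (χ : Character T) (x : T) : cval χ x ≠ 0 := Units.ne_zero _

theorem cval_neg (χ : Character T) (x : T) : cval χ (-x) = (cval χ x)⁻¹ := by
  simp [cval]

theorem cval_sub (χ : Character T) (x y : T) : cval χ (x - y) = cval χ x * (cval χ y)⁻¹ := by
  rw [sub_eq_add_neg, cval_add, cval_neg]

theorem cval_nsmul (χ : Character T) (k : ℕ) (x : T) : cval χ (k • x) = cval χ x ^ k := by
  simp [cval, ofAdd_nsmul]

theorem cval_zsmul (χ : Character T) (k : ℤ) (x : T) : cval χ (k • x) = cval χ x ^ k := by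
  simp [cval, ofAdd_zsmul]

theorem cval_charAct (w : T ≃ₗ[ℤ] T) (χ : Character T) (x : T) :
    cval (charAct w χ) x = cval χ (w⁻¹ x) := rfl

theorem cval_charAct_refl (i : I) (χ : Character T) (x : T) :
    cval (charAct (D.refl i) χ) x = cval χ (D.refl i x) := by
  rw [cval_charAct, D.refl_inv]

theorem character_ext {χ χ' : Character T} (h : ∀ x, cval χ x = cval χ' x) : χ = χ' :=
  MonoidHom.ext fun x => Units.ext (h x.toAdd)

theorem charAct_mul (w w' : T ≃ₗ[ℤ] T) (χ : Character T) :
    charAct (w * w') χ = charAct w (charAct w' χ) :=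
  character_ext fun x => by simp only [cval_charAct, mul_inv_rev, LinearEquiv.mul_apply]

theorem charAct_one (χ : Character T) : charAct 1 χ = χ :=
  character_ext fun x => by rw [cval_charAct, inv_one]; rfl

/-- The value of a character at `(X^x - X^{r_i(x)}) / (1 - X^{-α_i})`. -/
noncomputable def lusztigValue (χ : Character T) (i : I) (x : T) : Cq :=
  (∑ k ∈ Finset.range (D.coroot i x).toNat, cval χ (x - k • D.root i)) -
    ∑ k ∈ Finset.range (-D.coroot i x).toNat, cval χ (D.refl i x - k • D.root i)

/-- A geometric series in `χ(α_i)⁻¹`. Without division, the identity remains valid on the wall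
`χ(α_i) = 1`. -/
theorem lusztigValue_mul (χ : Character T) (i : I) (x : T) :
    lusztigValue D χ i x * (1 - (cval χ (D.root i))⁻¹) =
      cval χ x - cval χ (D.refl i x) := by
  have geom : ∀ (y : T) (m : ℕ), (∑ k ∈ Finset.range m, cval χ (y - k • D.root i)) *
      (1 - (cval χ (D.root i))⁻¹) = cval χ y - cval χ (y - m • D.root i) := by
    intro y m
    simp only [cval_sub, cval_nsmul, ← inv_pow, ← Finset.mul_sum]
    rw [mul_assoc, geom_sum_mul_neg]
    ring
  rw [lusztigValue, sub_mul, geom, geom]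
  rcases le_total 0 (D.coroot i x) with h | h
  · have h₁ : (-D.coroot i x).toNat = 0 := by omega
    have h₂ : (D.coroot i x).toNat • D.root i = D.coroot i x • D.root i := by
      rw [← natCast_zsmul, Int.toNat_of_nonneg h]
    rw [h₁, h₂, ← D.refl_apply]
    simp
  · have h₁ : (D.coroot i x).toNat = 0 := by omega
    have h₂ : (-D.coroot i x).toNat • D.root i = -(D.coroot i x • D.root i) := by
      rw [← natCast_zsmul, Int.toNat_of_nonneg (by omega), neg_smul]
    rw [h₁, h₂, D.refl_apply]
    simp

end Characters

/-! ### Weights of calibrated representations -/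

/-- Off-diagonal entries of the Cartan matrix are `0` or `-1`, symmetrically. -/
def SimpleRootDatum.SimplyLaced {I T : Type*} [AddCommGroup T] (D : SimpleRootDatum I T) : Prop :=
  ∀ i j, i ≠ j → (D.coroot i (D.root j) = 0 ∧ D.coroot j (D.root i) = 0) ∨
    (D.coroot i (D.root j) = -1 ∧ D.coroot j (D.root i) = -1)

section Order

variable {I T : Type*} [AddCommGroup T] (D : SimpleRootDatum I T)

theorem refl_comm {i j : I} (h₁ : D.coroot i (D.root j) = 0) (h₂ : D.coroot j (D.root i) = 0) :
    D.refl i * D.refl j = D.refl j * D.refl i := by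
  ext x
  simp only [LinearEquiv.mul_apply, D.refl_apply, map_sub, map_zsmul, h₁, h₂]
  module

theorem refl_braid {i j : I} (h₁ : D.coroot i (D.root j) = -1)
    (h₂ : D.coroot j (D.root i) = -1) :
    D.refl i * D.refl j * D.refl i = D.refl j * D.refl i * D.refl j := by
  ext x
  simp only [LinearEquiv.mul_apply, D.refl_apply, map_sub, map_zsmul, h₁, h₂,
    D.coroot_root_self, smul_eq_mul]
  module

theorem orderOf_refl_mul_refl_eq_two {i j : I} (h₁ : D.coroot i (D.root j) = 0)
    (h₂ : D.coroot j (D.root i) = 0) : orderOf (D.refl i * D.refl j) = 2 := by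
  refine orderOf_eq_prime ?_ fun h => ?_
  · rw [pow_two]
    nth_rw 2 [refl_comm D h₁ h₂]
    rw [mul_assoc, ← mul_assoc (D.refl j), D.refl_mul_self, one_mul, D.refl_mul_self]
  -- The product is not `1`: it sends `α_j` to `-α_j`, where `α_j^∨` is `-2` instead of `2`.
  · have := congrArg (fun w : T ≃ₗ[ℤ] T => D.coroot j (w (D.root j))) h
    simp [LinearEquiv.mul_apply, D.refl_apply, D.coroot_root_self, h₁] at this

theorem orderOf_refl_mul_refl_eq_three {i j : I} (h₁ : D.coroot i (D.root j) = -1)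
    (h₂ : D.coroot j (D.root i) = -1) : orderOf (D.refl i * D.refl j) = 3 := by
  refine orderOf_eq_prime ?_ fun h => ?_
  · have hb := refl_braid D h₁ h₂
    calc (D.refl i * D.refl j) ^ 3
        = (D.refl i * D.refl j * D.refl i) * (D.refl j * D.refl i * D.refl j) := by
          simp only [pow_succ, pow_zero, one_mul, mul_assoc]
      _ = (D.refl i * D.refl j * D.refl i) * (D.refl i * D.refl j * D.refl i) := by rw [hb]
      _ = D.refl i * (D.refl j * (D.refl i * D.refl i) * D.refl j) * D.refl i := by group
      _ = 1 := by simp [D.refl_mul_self]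
  · have := congrArg (fun w : T ≃ₗ[ℤ] T => D.coroot j (w (D.root j))) h
    simp [LinearEquiv.mul_apply, D.refl_apply, D.coroot_root_self, h₁, h₂] at this

end Order

/-- For a diagonalizable endomorphism generalized eigenvectors of rank two are eigenvectors. -/
theorem apply_eq_smul_of_diagonalizable {K V : Type*} [Field K] [AddCommGroup V] [Module K V]
    {f : Module.End K V} (hf : ⨆ c : K, Module.End.eigenspace f c = ⊤) {c : K} {u : V}
    (h : f (f u - c • u) = c • (f u - c • u)) : f u = c • u := by
  classical
  have hu : u ∈ ⨆ c : K, Module.End.eigenspace f c := hf ▸ Submodule.mem_top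
  -- Write `u` as a sum of eigenvectors `m_d`. The hypothesis becomes `(d - c)² m_d = 0` for each
  -- `d`, hence `(d - c) m_d = 0`.
  rw [Submodule.mem_iSup_iff_exists_dfinsupp'] at hu
  obtain ⟨m, rfl⟩ := hu
  have hind := f.eigenspaces_iSupIndep
  have hm : ∀ d, f (m d : V) = d • (m d : V) := fun d => Module.End.mem_eigenspace_iff.1 (m d).2
  have hsum : ∀ (p : K → K), (m.sum fun d x => p d • (x : V)) = 0 → ∀ d, p d • m d = 0 := by
    intro p hp d
    have hinj := hind.dfinsupp_lsum_injective
    let m' : Π₀ d, Module.End.eigenspace f d := m.mapRange (fun d x => p d • x) fun d => by simp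
    have h0 : m' = 0 := by
      apply hinj
      rw [map_zero]
      simp only [m', DFinsupp.lsum_apply_apply, DFinsupp.sumAddHom_apply]
      rw [DFinsupp.sum_mapRange_index (by simp)]
      simpa using hp
    have := congrArg (fun z : Π₀ d, Module.End.eigenspace f d => z d) h0
    simpa [m'] using this
  have hfm : ∀ p : K → K, f (m.sum fun d x => p d • (x : V)) =
      m.sum fun d x => (p d * d) • (x : V) := by
    intro p
    simp only [DFinsupp.sum, map_sum, map_smul, hm, smul_smul]
  have hcm : ∀ (c : K) (p : K → K), (c • m.sum fun d x => p d • (x : V)) =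
      m.sum fun d x => (c * p d) • (x : V) := by
    intro c p
    simp only [DFinsupp.sum, Finset.smul_sum, smul_smul]
  have hsub : ∀ p p' : K → K,
      ((m.sum fun d x => p d • (x : V)) - m.sum fun d x => p' d • (x : V)) =
      m.sum fun d x => (p d - p' d) • (x : V) := by
    intro p p'
    simp only [DFinsupp.sum, ← Finset.sum_sub_distrib, sub_smul]
  have h1 : (m.sum fun _ x => (x : V)) = m.sum fun _ x => (1 : K) • (x : V) := by simp
  rw [h1] at h ⊢
  rw [hfm, hcm, hsub, hfm, hcm, ← sub_eq_zero, hsub] at h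
  rw [hfm, hcm, ← sub_eq_zero, hsub]
  refine Finset.sum_eq_zero fun d _ => ?_
  have := hsum _ h d
  rw [smul_eq_zero] at this
  rcases this with h' | h'
  · have : (d - c) ^ 2 = 0 := by rw [← h']; ring
    have := pow_eq_zero_iff (two_ne_zero) |>.1 this
    have hz : 1 * d - c * 1 = 0 := by rw [← this]; ring
    change (1 * d - c * 1) • (m d : V) = 0
    rw [hz, zero_smul]
  · rw [h']; simp

section Weights

variable {I T : Type*} [AddCommGroup T] {D : SimpleRootDatum I T}
variable {V : Type*} [AddCommGroup V] [Module Cq V]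

/-- `w` is a vector of weight `χ`. -/
def IsWeightVector (ρ : CqHecke D →ₐ[Cq] Module.End Cq V) (χ : Character T) (w : V) : Prop :=
  w ≠ 0 ∧ ∀ x, ρ (cqX D x) w = cval χ x • w

variable {ρ : CqHecke D →ₐ[Cq] Module.End Cq V} {χ : Character T} {w : V}

theorem IsWeightVector.lusztig (hw : IsWeightVector ρ χ w) (i : I) (x : T) :
    cval χ x • ρ (cqG D i) w - ρ (cqX D (D.refl i x)) (ρ (cqG D i) w) =
      (((q : Cq) - (q : Cq)⁻¹) * lusztigValue D χ i x) • w := by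
  have h := congrArg (fun z => ρ z w) (cqG_lusztig D i x)
  simp only [map_sub, map_mul, map_smul, map_sum, LinearMap.sub_apply, Module.End.mul_apply,
    LinearMap.smul_apply, LinearMap.sum_apply, hw.2, ← Finset.sum_smul, ← sub_smul] at h
  rw [h, lusztigValue, smul_smul]

/-- Calibrated representations have no weights on the walls. -/
theorem IsWeightVector.cval_root_ne_one (hρ : IsCalibrated D ρ) (hw : IsWeightVector ρ χ w)
    (i : I) : cval χ (D.root i) ≠ 1 := by
  intro h
  -- For `x = -α_i` the relation makes `(X^{α_i} - 1) g_i w` a nonzero multiple of `w`, while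
  -- `X^{α_i}` fixes `w`. So `g_i w` would be a generalized eigenvector of rank two that is not an
  -- eigenvector.
  have hl := hw.lusztig i (-D.root i)
  have hval : cval χ (-D.root i) = 1 := by rw [cval_neg, h, inv_one]
  have hL : lusztigValue D χ i (-D.root i) = -2 := by
    have hk : ∀ (y : T) (k : ℕ), cval χ (y - k • D.root i) = cval χ y := fun y k => by
      rw [cval_sub, cval_nsmul, h]
      simp
    rw [lusztigValue, map_neg, D.coroot_root_self, neg_neg]
    simp only [hk, map_neg, D.refl_root_self, neg_neg, h]
    norm_num [show Int.toNat 2 = 2 from rfl]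
  rw [hval, hL, map_neg, D.refl_root_self, neg_neg, one_smul] at hl
  set u := ρ (cqG D i) w
  set f := ρ (cqX D (D.root i))
  have hfw : f w = w := by rw [hw.2, h, one_smul]
  have hfu : f u - (1 : Cq) • u = -((((q : Cq) - (q : Cq)⁻¹) * -2) • w) := by
    rw [← hl, one_smul, neg_sub]
  have := apply_eq_smul_of_diagonalizable (hρ (D.root i)) (c := 1) (u := u) (by
    rw [hfu, map_neg, map_smul, hfw, one_smul])
  rw [← sub_eq_zero, hfu, neg_eq_zero, smul_eq_zero] at this
  rcases this with h' | h'
  · exact mul_ne_zero q_sub_inv_ne_zero (by norm_num) h'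
  · exact hw.1 h'

/-- The action of `g_i` on a weight vector is by a scalar, or the reflected character is also
a weight. -/
theorem IsWeightVector.refl_or_eigen (hw : IsWeightVector ρ χ w) (i : I)
    (h : cval χ (D.root i) ≠ 1) :
    (∃ w', IsWeightVector ρ (charAct (D.refl i) χ) w') ∨
      (ρ (cqG D i) w = (q : Cq) • w ∧ cval χ (D.root i) = (q : Cq) ^ 2) ∨
      (ρ (cqG D i) w = -(q : Cq)⁻¹ • w ∧ cval χ (D.root i) = ((q : Cq) ^ 2)⁻¹) := by
  set c := cval χ (D.root i)
  have hc0 : c ≠ 0 := cval_ne_zero _ _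
  have hq0 : (q : Cq) ≠ 0 := Units.ne_zero _
  have hc1 : c - 1 ≠ 0 := sub_ne_zero.2 h
  have hc' : 1 - c⁻¹ ≠ 0 := by
    intro h'
    rw [sub_eq_zero, eq_comm, inv_eq_one] at h'
    exact h h'
  -- The scalar for which `g_i - a` intertwines the weights `χ` and `r_i(χ)`. If `g_i w = a w`, the
  -- quadratic relation leaves only `a = q` or `a = -q⁻¹`, that is, `χ(α_i) = q^{±2}`.
  set a : Cq := ((q : Cq) - (q : Cq)⁻¹) / (1 - c⁻¹)
  have ha : a = ((q : Cq) - (q : Cq)⁻¹) * c / (c - 1) := by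
    simp only [a]
    field_simp
  by_cases hu : ρ (cqG D i) w = a • w
  · right
    have hquad := congrArg (fun z => ρ z w) (cqG_quadratic D i)
    simp only [map_mul, map_add, map_smul, map_one, Module.End.mul_apply, LinearMap.add_apply,
      LinearMap.smul_apply, Module.End.one_apply, hu, smul_smul] at hquad
    have hquad' : (a * a - (((q : Cq) - (q : Cq)⁻¹) * a + 1)) • w = 0 := by
      rw [sub_smul, add_smul, one_smul, hquad, sub_self]
    have hfac : (a - q) * (a + (q : Cq)⁻¹) = 0 := by
      have := (smul_eq_zero.1 hquad').resolve_right hw.1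
      rw [← this]
      field_simp
      ring
    rcases mul_eq_zero.1 hfac with h' | h'
    · left
      have haq : a = q := sub_eq_zero.1 h'
      refine ⟨by rw [hu, haq], ?_⟩
      rw [ha] at haq
      field_simp at haq
      linear_combination -haq
    · right
      have haq : a = -(q : Cq)⁻¹ := eq_neg_of_add_eq_zero_left h'
      refine ⟨by rw [hu, haq], ?_⟩
      rw [ha] at haq
      field_simp at haq ⊢
      linear_combination haq
  · left
    refine ⟨ρ (cqG D i) w - a • w, sub_ne_zero.2 hu, fun x => ?_⟩
    have hl := hw.lusztig i (D.refl i x)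
    have hL : ((q : Cq) - (q : Cq)⁻¹) * lusztigValue D χ i (D.refl i x) =
        a * (cval χ (D.refl i x) - cval χ x) := by
      have hm : lusztigValue D χ i (D.refl i x) * (1 - c⁻¹) = _ :=
        lusztigValue_mul D χ i (D.refl i x)
      rw [D.refl_refl] at hm
      rw [← hm, div_mul_eq_mul_div, eq_div_iff hc']
      ring
    rw [hL, D.refl_refl, sub_eq_iff_eq_add, ← sub_eq_iff_eq_add'] at hl
    rw [map_sub, map_smul, hw.2, ← hl, cval_charAct_refl, smul_sub, smul_smul, smul_smul,
      mul_sub, sub_smul, mul_comm a, mul_comm a]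
    abel

/-- The weights of a calibrated representation are closed under truncated reflections. -/
theorem IsWeightVector.exists_refl (hρ : IsCalibrated D ρ) (hw : IsWeightVector ρ χ w) {i : I}
    (h₁ : cval χ (D.root i) ≠ (q : Cq) ^ 2) (h₂ : cval χ (D.root i) ≠ ((q : Cq) ^ 2)⁻¹) :
    ∃ w', IsWeightVector ρ (charAct (D.refl i) χ) w' := by
  rcases hw.refl_or_eigen i (hw.cval_root_ne_one hρ i) with h | h | h
  · exact h
  · exact absurd h.2 h₁
  · exact absurd h.2 h₂

/-- If the product were `1`, then `r_i(χ)` would take the value `1` at `α_j` and vice versa, so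
neither reflected character is a weight. Hence `g_i` and `g_j` act on `w` by scalars in `{q, -q⁻¹}`.
Equal scalars contradict the product being `1`, as `q⁴ ≠ 1`; different ones contradict the braid
relation, since `sts = tst` forces `s = t`. -/
theorem IsWeightVector.cval_root_add_root_ne_one (hρ : IsCalibrated D ρ)
    (hw : IsWeightVector ρ χ w) {i j : I} (hij : i ≠ j) (h₁ : D.coroot i (D.root j) = -1)
    (h₂ : D.coroot j (D.root i) = -1) : cval χ (D.root i) * cval χ (D.root j) ≠ 1 := by
  intro h
  have hnot : ∀ i j : I, D.coroot i (D.root j) = -1 → cval χ (D.root i) * cval χ (D.root j) = 1 →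
      ¬ ∃ w', IsWeightVector ρ (charAct (D.refl i) χ) w' := by
    rintro i j hc h ⟨w', hw'⟩
    refine hw'.cval_root_ne_one hρ j ?_
    rw [cval_charAct_refl, D.refl_apply, hc, neg_one_zsmul, sub_neg_eq_add, cval_add, mul_comm, h]
  have hi := (hw.refl_or_eigen i (hw.cval_root_ne_one hρ i)).resolve_left (hnot i j h₁ h)
  have hj := (hw.refl_or_eigen j (hw.cval_root_ne_one hρ j)).resolve_left
    (hnot j i h₂ (by rw [mul_comm, h]))
  have hq0 : (q : Cq) ≠ 0 := Units.ne_zero _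
  have hq4 : ((q : Cq) ^ 2) * (q : Cq) ^ 2 ≠ 1 := by
    intro h'
    have : q ^ (4 : ℤ) = 1 := Units.ext (by simpa [← pow_add] using h')
    exact absurd ((q_zpow_eq_one_iff 4).1 this) (by decide)
  have hq2 : (q : Cq) ^ 2 ≠ -1 := fun h' => hq4 (by rw [h']; norm_num)
  have hb := congrArg (fun z => ρ z w) (cqG_braid D hij)
  rw [orderOf_refl_mul_refl_eq_three D h₁ h₂] at hb
  simp only [altProd, mul_one, map_mul, Module.End.mul_apply] at hb
  have hsq : ∀ s t : Cq, s ≠ 0 → t ≠ 0 → (s * t * s) • w = (t * s * t) • w → s = t := by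
    intro s t hs ht hst
    have h0 : (s * t * (s - t)) • w = 0 := by
      rw [show s * t * (s - t) = s * t * s - t * s * t by ring, sub_smul, hst, sub_self]
    have := (smul_eq_zero.1 h0).resolve_right hw.1
    exact sub_eq_zero.1 ((mul_eq_zero.1 this).resolve_left (mul_ne_zero hs ht))
  have hqi : (q : Cq) ≠ -(q : Cq)⁻¹ := fun h' => hq2 (by
    calc (q : Cq) ^ 2 = q * q := by ring
      _ = q * -(q : Cq)⁻¹ := by rw [← h']
      _ = -1 := by field_simp)
  rcases hi with ⟨hi, hi'⟩ | ⟨hi, hi'⟩ <;> rcases hj with ⟨hj, hj'⟩ | ⟨hj, hj'⟩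
  · rw [hi', hj'] at h
    exact hq4 h
  · simp only [hi, hj, map_smul, smul_smul] at hb
    exact hqi (hsq q (-(q : Cq)⁻¹) hq0 (by simp) (by convert hb using 2))
  · simp only [hi, hj, map_smul, smul_smul] at hb
    exact hqi (hsq (-(q : Cq)⁻¹) q (by simp) hq0 (by convert hb using 2)).symm
  · rw [hi', hj', ← mul_inv, inv_eq_one] at h
    exact hq4 h

end Weights

/-! ### Calibrated representations on truncated orbits -/

/-- The diagonal coefficient of `g_i` on a weight vector with `χ(α_i) = c`. -/
noncomputable def diagCoeff (c : Cq) : Cq := ((q : Cq) - (q : Cq)⁻¹) * c / (c - 1)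

open Classical in
/-- The off-diagonal coefficient of `g_i` on a weight vector with `χ(α_i) = c`. -/
noncomputable def offCoeff (c : Cq) : Cq :=
  if c = (q : Cq) ^ 2 ∨ c = ((q : Cq) ^ 2)⁻¹ then 0 else ((q : Cq) * c - (q : Cq)⁻¹) / (c - 1)

/-- The trace condition: on the span of the vectors of `S` and `s_i S` the operator `g_i` has trace
`q - q⁻¹`. `offCoeff_mul_inv` is the determinant condition, with value `-1`; together they give the
quadratic relation. -/
theorem diagCoeff_inv {c : Cq} (hc : c ≠ 0) (h : c ≠ 1) :
    diagCoeff c⁻¹ = (q : Cq) - (q : Cq)⁻¹ - diagCoeff c := by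
  have h₁ : c - 1 ≠ 0 := sub_ne_zero.2 h
  have h₂ : 1 - c ≠ 0 := sub_ne_zero.2 h.symm
  have hq0 : (q : Cq) ≠ 0 := Units.ne_zero _
  simp only [diagCoeff]
  field_simp
  ring

/-- Setting the coefficients to `0` at `c = q^{±2}` does not change their product, because one of
the two untruncated factors vanishes there anyway. -/
theorem offCoeff_mul_inv {c : Cq} (hc : c ≠ 0) (h : c ≠ 1) :
    offCoeff c * offCoeff c⁻¹ =
      1 + ((q : Cq) - (q : Cq)⁻¹) * diagCoeff c - diagCoeff c * diagCoeff c := by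
  have h₁ : c - 1 ≠ 0 := sub_ne_zero.2 h
  have h₂ : 1 - c ≠ 0 := sub_ne_zero.2 h.symm
  have hq0 : (q : Cq) ≠ 0 := Units.ne_zero _
  have key : ((q : Cq) * c - (q : Cq)⁻¹) / (c - 1) * (((q : Cq) * c⁻¹ - (q : Cq)⁻¹) / (c⁻¹ - 1)) =
      1 + ((q : Cq) - (q : Cq)⁻¹) * diagCoeff c - diagCoeff c * diagCoeff c := by
    simp only [diagCoeff]
    field_simp
    ring
  by_cases hb : c = (q : Cq) ^ 2 ∨ c = ((q : Cq) ^ 2)⁻¹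
  · rw [← key, offCoeff, if_pos hb, zero_mul, eq_comm]
    rcases hb with rfl | rfl
    · refine mul_eq_zero_of_right _ ?_
      field_simp
      simp
    · refine mul_eq_zero_of_left ?_ _
      field_simp
      simp
  · have hb' : ¬ (c⁻¹ = (q : Cq) ^ 2 ∨ c⁻¹ = ((q : Cq) ^ 2)⁻¹) := by
      rw [inv_eq_iff_eq_inv, inv_inj]
      tauto
    rw [offCoeff, offCoeff, if_neg hb, if_neg hb', key]

/-- Merges the two contributions to the coefficient of `s_i S` in `g_i g_j g_i` applied to the
vector of `S`, with `x = χ(α_i)` and `y = χ(α_j)`. -/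
theorem diagCoeff_cocycle {x y : Cq} (hx : x ≠ 0) (hy : y ≠ 0) (hx₁ : x ≠ 1) (hy₁ : y ≠ 1)
    (hxy : x * y ≠ 1) :
    diagCoeff x * diagCoeff y + diagCoeff (x * y) * diagCoeff x⁻¹ =
      diagCoeff y * diagCoeff (x * y) := by
  have h₁ : x - 1 ≠ 0 := sub_ne_zero.2 hx₁
  have h₂ : 1 - x ≠ 0 := sub_ne_zero.2 hx₁.symm
  have h₃ : y - 1 ≠ 0 := sub_ne_zero.2 hy₁
  have h₄ : x * y - 1 ≠ 0 := sub_ne_zero.2 hxy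
  have hq0 : (q : Cq) ≠ 0 := Units.ne_zero _
  simp only [diagCoeff]
  field_simp
  ring

/-- The coefficient of `S` itself in `g_i g_j g_i` and in `g_j g_i g_j`: the only one whose
agreement is not visible from the expansion. -/
theorem diagCoeff_offCoeff_symm {x y : Cq} (hx : x ≠ 0) (hy : y ≠ 0) (hx₁ : x ≠ 1) (hy₁ : y ≠ 1)
    (hxy : x * y ≠ 1) :
    diagCoeff x * diagCoeff y * diagCoeff x + offCoeff x * offCoeff x⁻¹ * diagCoeff (x * y) =
      diagCoeff y * diagCoeff x * diagCoeff y + offCoeff y * offCoeff y⁻¹ * diagCoeff (x * y) := by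
  have h₁ : x - 1 ≠ 0 := sub_ne_zero.2 hx₁
  have h₃ : y - 1 ≠ 0 := sub_ne_zero.2 hy₁
  have h₄ : x * y - 1 ≠ 0 := sub_ne_zero.2 hxy
  have hq0 : (q : Cq) ≠ 0 := Units.ne_zero _
  rw [offCoeff_mul_inv hx hx₁, offCoeff_mul_inv hy hy₁]
  simp only [diagCoeff]
  field_simp
  ring

/-- A finite set of characters, indexed by a subset `O` of `σ`, that is closed under truncated
reflections and stays away from the walls. -/
structure CalibratedOrbit {I T : Type*} [AddCommGroup T] (D : SimpleRootDatum I T)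
    (σ : Type) where
  ev : σ → Character T
  ev_injective : Function.Injective ev
  s : I → σ → σ
  ev_s : ∀ i S, ev (s i S) = charAct (D.refl i) (ev S)
  O : Set σ
  finite : O.Finite
  root_ne_one : ∀ S ∈ O, ∀ i, cval (ev S) (D.root i) ≠ 1
  root_add_root_ne_one : ∀ S ∈ O, ∀ i j, D.coroot i (D.root j) = -1 →
    cval (ev S) (D.root i) * cval (ev S) (D.root j) ≠ 1
  closed : ∀ S ∈ O, ∀ i, cval (ev S) (D.root i) ≠ (q : Cq) ^ 2 →
    cval (ev S) (D.root i) ≠ ((q : Cq) ^ 2)⁻¹ → s i S ∈ O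

namespace CalibratedOrbit

variable {I T : Type*} [AddCommGroup T] {D : SimpleRootDatum I T} {σ : Type}
  (𝒪 : CalibratedOrbit D σ)

/-- The value of the character at the simple root. -/
noncomputable def c (i : I) (S : σ) : Cq := cval (𝒪.ev S) (D.root i)

theorem c_ne_zero (i : I) (S : σ) : 𝒪.c i S ≠ 0 := cval_ne_zero _ _

theorem c_s (i j : I) (S : σ) :
    𝒪.c j (𝒪.s i S) = 𝒪.c j S * (𝒪.c i S ^ D.coroot i (D.root j))⁻¹ := by
  rw [c, 𝒪.ev_s, cval_charAct_refl, D.refl_apply, cval_sub, cval_zsmul]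
  rfl

theorem c_s_self (i : I) (S : σ) : 𝒪.c i (𝒪.s i S) = (𝒪.c i S)⁻¹ := by
  have h := 𝒪.c_ne_zero i S
  rw [c_s, D.coroot_root_self]
  simp only [zpow_ofNat]
  field_simp

theorem s_s (i : I) (S : σ) : 𝒪.s i (𝒪.s i S) = S :=
  𝒪.ev_injective (by rw [𝒪.ev_s, 𝒪.ev_s, ← charAct_mul, D.refl_mul_self, charAct_one])

open Classical in
/-- The basis vector of the orbit module for an element of the orbit, and `0` for other elements. -/
noncomputable def δ (S : σ) : 𝒪.O →₀ Cq :=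
  if h : S ∈ 𝒪.O then Finsupp.single ⟨S, h⟩ 1 else 0

theorem δ_coe (S : 𝒪.O) : 𝒪.δ S = Finsupp.single S 1 := by
  rw [δ, dif_pos S.2]

/-- The operator of `g_i`. -/
noncomputable def gOp (i : I) : Module.End Cq (𝒪.O →₀ Cq) :=
  Finsupp.linearCombination Cq fun S : 𝒪.O =>
    diagCoeff (𝒪.c i S) • 𝒪.δ S + offCoeff (𝒪.c i S) • 𝒪.δ (𝒪.s i S)

/-- The operator of `X^x`. -/
noncomputable def xOp (x : T) : Module.End Cq (𝒪.O →₀ Cq) :=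
  Finsupp.linearCombination Cq fun S : 𝒪.O => cval (𝒪.ev S) x • 𝒪.δ S

theorem gOp_δ (i : I) {S : σ} (hS : S ∈ 𝒪.O) :
    𝒪.gOp i (𝒪.δ S) = diagCoeff (𝒪.c i S) • 𝒪.δ S + offCoeff (𝒪.c i S) • 𝒪.δ (𝒪.s i S) := by
  rw [𝒪.δ_coe ⟨S, hS⟩, gOp, Finsupp.linearCombination_single, one_smul, 𝒪.δ_coe ⟨S, hS⟩]

/-- Outside the orbit `δ S` is `0`, whereas the right-hand side of the formula for `g_i` may still
involve a vector of the orbit. Carrying a coefficient that vanishes there lets the formula be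
iterated without case distinctions. -/
theorem smul_gOp_δ (i : I) {S : σ} {t : Cq} (hS : t ≠ 0 → S ∈ 𝒪.O) :
    t • 𝒪.gOp i (𝒪.δ S) =
      (t * diagCoeff (𝒪.c i S)) • 𝒪.δ S + (t * offCoeff (𝒪.c i S)) • 𝒪.δ (𝒪.s i S) := by
  by_cases ht : t = 0
  · simp [ht]
  · rw [𝒪.gOp_δ i (hS ht), smul_add, smul_smul, smul_smul]

theorem mem_of_offCoeff_ne_zero (i : I) {S : σ} {t : Cq} (hS : t ≠ 0 → S ∈ 𝒪.O)
    (h : t * offCoeff (𝒪.c i S) ≠ 0) : 𝒪.s i S ∈ 𝒪.O := by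
  have hS := hS (left_ne_zero_of_mul h)
  have h := right_ne_zero_of_mul h
  rw [offCoeff] at h
  split_ifs at h with h'
  · exact absurd rfl h
  · rw [not_or] at h'
    exact 𝒪.closed S hS i h'.1 h'.2

theorem xOp_δ (x : T) (S : σ) : 𝒪.xOp x (𝒪.δ S) = cval (𝒪.ev S) x • 𝒪.δ S := by
  by_cases hS : S ∈ 𝒪.O
  · rw [𝒪.δ_coe ⟨S, hS⟩, xOp, Finsupp.linearCombination_single, one_smul, 𝒪.δ_coe ⟨S, hS⟩]
  · simp [δ, dif_neg hS]

theorem end_ext {f g : Module.End Cq (𝒪.O →₀ Cq)} (h : ∀ S ∈ 𝒪.O, f (𝒪.δ S) = g (𝒪.δ S)) :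
    f = g := by
  refine Finsupp.lhom_ext' fun S => LinearMap.ext_ring ?_
  have := h S S.2
  rwa [δ_coe] at this

theorem gOp_quadratic (i : I) :
    𝒪.gOp i * 𝒪.gOp i = ((q : Cq) - (q : Cq)⁻¹) • 𝒪.gOp i + 1 := by
  refine 𝒪.end_ext fun S hS => ?_
  have h1 := 𝒪.root_ne_one S hS i
  have hmem := 𝒪.mem_of_offCoeff_ne_zero i (S := S) (t := 1) fun _ => hS
  rw [one_mul] at hmem
  simp only [Module.End.mul_apply, LinearMap.add_apply, LinearMap.smul_apply, Module.End.one_apply]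
  rw [𝒪.gOp_δ i hS, map_add, map_smul, map_smul, 𝒪.gOp_δ i hS, 𝒪.smul_gOp_δ i hmem,
    𝒪.c_s_self, 𝒪.s_s, offCoeff_mul_inv (𝒪.c_ne_zero i S) h1, diagCoeff_inv (𝒪.c_ne_zero i S) h1]
  let _ : Algebra ℕ Cq := Semiring.toNatAlgebra
  let _ : Algebra ℤ Cq := Ring.toIntAlgebra _
  module

theorem gOp_lusztig (i : I) (x : T) :
    𝒪.gOp i * 𝒪.xOp x - 𝒪.xOp (D.refl i x) * 𝒪.gOp i = ((q : Cq) - (q : Cq)⁻¹) •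
      ((∑ k ∈ Finset.range (D.coroot i x).toNat, 𝒪.xOp (x - k • D.root i)) -
        ∑ k ∈ Finset.range (-D.coroot i x).toNat, 𝒪.xOp (D.refl i x - k • D.root i)) := by
  refine 𝒪.end_ext fun S hS => ?_
  have h1 : 𝒪.c i S ≠ 1 := 𝒪.root_ne_one S hS i
  have h0 := 𝒪.c_ne_zero i S
  have h1' : 𝒪.c i S - 1 ≠ 0 := sub_ne_zero.2 h1
  simp only [LinearMap.sub_apply, LinearMap.smul_apply, LinearMap.sum_apply, Module.End.mul_apply,
    xOp_δ, ← Finset.sum_smul, ← sub_smul, map_smul]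
  rw [𝒪.gOp_δ i hS, map_add, map_smul, map_smul, xOp_δ, xOp_δ, 𝒪.ev_s, cval_charAct_refl,
    D.refl_refl, smul_smul]
  have hL : lusztigValue D (𝒪.ev S) i x * (1 - (𝒪.c i S)⁻¹) = _ :=
    lusztigValue_mul D (𝒪.ev S) i x
  have hd : diagCoeff (𝒪.c i S) * (1 - (𝒪.c i S)⁻¹) = (q : Cq) - (q : Cq)⁻¹ := by
    rw [diagCoeff]
    field_simp
  change _ = ((q : Cq) - (q : Cq)⁻¹) • lusztigValue D (𝒪.ev S) i x • 𝒪.δ S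
  have : ((q : Cq) - (q : Cq)⁻¹) * lusztigValue D (𝒪.ev S) i x =
      diagCoeff (𝒪.c i S) * (cval (𝒪.ev S) x - cval (𝒪.ev S) (D.refl i x)) := by
    rw [← hL, ← hd]
    ring
  rw [smul_smul (_ - _), this]
  let _ : Algebra ℕ Cq := Semiring.toNatAlgebra
  let _ : Algebra ℤ Cq := Ring.toIntAlgebra _
  module

theorem gOp_comm {i j : I} (h₁ : D.coroot i (D.root j) = 0) (h₂ : D.coroot j (D.root i) = 0) :
    𝒪.gOp i * 𝒪.gOp j = 𝒪.gOp j * 𝒪.gOp i := by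
  refine 𝒪.end_ext fun S hS => ?_
  have hi := 𝒪.mem_of_offCoeff_ne_zero i (S := S) (t := 1) fun _ => hS
  have hj := 𝒪.mem_of_offCoeff_ne_zero j (S := S) (t := 1) fun _ => hS
  rw [one_mul] at hi hj
  have hij : 𝒪.c j (𝒪.s i S) = 𝒪.c j S := by simp [c_s, h₁]
  have hji : 𝒪.c i (𝒪.s j S) = 𝒪.c i S := by simp [c_s, h₂]
  have hs : 𝒪.s i (𝒪.s j S) = 𝒪.s j (𝒪.s i S) := 𝒪.ev_injective (by
    simp only [𝒪.ev_s, ← charAct_mul, refl_comm D h₁ h₂])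
  simp only [Module.End.mul_apply]
  rw [𝒪.gOp_δ j hS, 𝒪.gOp_δ i hS, map_add, map_add, map_smul, map_smul, map_smul, map_smul,
    𝒪.gOp_δ i hS, 𝒪.gOp_δ j hS, 𝒪.smul_gOp_δ i hj, 𝒪.smul_gOp_δ j hi, hij, hji, hs]
  let _ : Algebra ℕ Cq := Semiring.toNatAlgebra
  let _ : Algebra ℤ Cq := Ring.toIntAlgebra _
  module

/-- The expansion of `g_i g_j g_i` on a basis vector. -/
theorem gOp_gOp_gOp_δ {i j : I} (h₁ : D.coroot i (D.root j) = -1)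
    (h₂ : D.coroot j (D.root i) = -1) {S : σ} (hS : S ∈ 𝒪.O) :
    𝒪.gOp i (𝒪.gOp j (𝒪.gOp i (𝒪.δ S))) =
      (diagCoeff (𝒪.c i S) * diagCoeff (𝒪.c j S) * diagCoeff (𝒪.c i S) +
        offCoeff (𝒪.c i S) * offCoeff (𝒪.c i S)⁻¹ * diagCoeff (𝒪.c i S * 𝒪.c j S)) • 𝒪.δ S +
      (offCoeff (𝒪.c i S) * (diagCoeff (𝒪.c j S) * diagCoeff (𝒪.c i S * 𝒪.c j S))) •
        𝒪.δ (𝒪.s i S) +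
      (offCoeff (𝒪.c j S) * (diagCoeff (𝒪.c i S) * diagCoeff (𝒪.c i S * 𝒪.c j S))) •
        𝒪.δ (𝒪.s j S) +
      (diagCoeff (𝒪.c i S) * offCoeff (𝒪.c j S) * offCoeff (𝒪.c i S * 𝒪.c j S)) •
        𝒪.δ (𝒪.s i (𝒪.s j S)) +
      (diagCoeff (𝒪.c j S) * offCoeff (𝒪.c i S) * offCoeff (𝒪.c i S * 𝒪.c j S)) •
        𝒪.δ (𝒪.s j (𝒪.s i S)) +
      (offCoeff (𝒪.c i S) * offCoeff (𝒪.c j S) * offCoeff (𝒪.c i S * 𝒪.c j S)) •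
        𝒪.δ (𝒪.s i (𝒪.s j (𝒪.s i S))) := by
  have hx := 𝒪.c_ne_zero i S
  have hy := 𝒪.c_ne_zero j S
  have hx₁ : 𝒪.c i S ≠ 1 := 𝒪.root_ne_one S hS i
  have hy₁ : 𝒪.c j S ≠ 1 := 𝒪.root_ne_one S hS j
  have hxy : 𝒪.c i S * 𝒪.c j S ≠ 1 := 𝒪.root_add_root_ne_one S hS i j h₁
  have hii := 𝒪.c_s_self i S
  have hij : 𝒪.c j (𝒪.s i S) = 𝒪.c i S * 𝒪.c j S := by
    rw [c_s, h₁, zpow_neg_one, inv_inv, mul_comm]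
  have hji : 𝒪.c i (𝒪.s j S) = 𝒪.c i S * 𝒪.c j S := by
    rw [c_s, h₂, zpow_neg_one, inv_inv]
  have hiji : 𝒪.c i (𝒪.s j (𝒪.s i S)) = 𝒪.c j S := by
    rw [c_s, h₂, zpow_neg_one, inv_inv, hii, hij]
    field_simp
  have mi : offCoeff (𝒪.c i S) ≠ 0 → 𝒪.s i S ∈ 𝒪.O := by
    simpa using 𝒪.mem_of_offCoeff_ne_zero i (S := S) (t := 1) fun _ => hS
  have mj : offCoeff (𝒪.c j S) ≠ 0 → 𝒪.s j S ∈ 𝒪.O := by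
    simpa using 𝒪.mem_of_offCoeff_ne_zero j (S := S) (t := 1) fun _ => hS
  have mji := fun h => 𝒪.mem_of_offCoeff_ne_zero j (t := offCoeff (𝒪.c i S)) mi h
  have hco := diagCoeff_cocycle hx hy hx₁ hy₁ hxy
  rw [𝒪.gOp_δ i hS, map_add, map_smul, map_smul, 𝒪.gOp_δ j hS, 𝒪.smul_gOp_δ j mi]
  simp only [map_add, map_smul, smul_add, smul_smul]
  rw [𝒪.smul_gOp_δ i (t := diagCoeff (𝒪.c i S) * diagCoeff (𝒪.c j S)) (fun _ => hS),
    𝒪.smul_gOp_δ i (t := diagCoeff (𝒪.c i S) * offCoeff (𝒪.c j S))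
      (fun h => mj (right_ne_zero_of_mul h)),
    𝒪.smul_gOp_δ i (t := offCoeff (𝒪.c i S) * diagCoeff (𝒪.c j (𝒪.s i S)))
      (fun h => mi (left_ne_zero_of_mul h)),
    𝒪.smul_gOp_δ i mji, hij, hji, hiji, hii, 𝒪.s_s, ← hco]
  let _ : Algebra ℕ Cq := Semiring.toNatAlgebra
  let _ : Algebra ℤ Cq := Ring.toIntAlgebra _
  module

/-- The expansion of `g_i g_j g_i` is symmetric in `i` and `j` term by term, up to the braid
relation of the reflections in the longest term and `diagCoeff_offCoeff_symm` in the shortest. -/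
theorem gOp_braid {i j : I} (h₁ : D.coroot i (D.root j) = -1) (h₂ : D.coroot j (D.root i) = -1) :
    𝒪.gOp i * (𝒪.gOp j * 𝒪.gOp i) = 𝒪.gOp j * (𝒪.gOp i * 𝒪.gOp j) := by
  refine 𝒪.end_ext fun S hS => ?_
  have hs : 𝒪.s i (𝒪.s j (𝒪.s i S)) = 𝒪.s j (𝒪.s i (𝒪.s j S)) := 𝒪.ev_injective (by
    simp only [𝒪.ev_s, ← charAct_mul, ← mul_assoc, refl_braid D h₁ h₂])
  simp only [Module.End.mul_apply]
  rw [𝒪.gOp_gOp_gOp_δ h₁ h₂ hS, 𝒪.gOp_gOp_gOp_δ h₂ h₁ hS, hs,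
    diagCoeff_offCoeff_symm (𝒪.c_ne_zero i S) (𝒪.c_ne_zero j S) (𝒪.root_ne_one S hS i)
      (𝒪.root_ne_one S hS j) (𝒪.root_add_root_ne_one S hS i j h₁), mul_comm (𝒪.c j S)]
  let _ : Algebra ℕ Cq := Semiring.toNatAlgebra
  let _ : Algebra ℤ Cq := Ring.toIntAlgebra _
  module

/-- The characters of a finite truncated orbit away from the walls lie in the
calibrated spectrum. -/
theorem ev_mem_CSpec (hD : D.SimplyLaced) {S : σ} (hS : S ∈ 𝒪.O) : 𝒪.ev S ∈ CSpec D := by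
  obtain ⟨ρ, hρ⟩ := exists_algHom D 𝒪.gOp 𝒪.xOp
    (𝒪.end_ext fun S _ => by rw [xOp_δ, cval_zero, one_smul]; rfl)
    (fun x y => 𝒪.end_ext fun S _ => by
      rw [xOp_δ, cval_add, Module.End.mul_apply, xOp_δ, map_smul, xOp_δ, smul_smul, mul_comm])
    𝒪.gOp_quadratic
    (fun i j hij => by
      rcases hD i j hij with ⟨h₁, h₂⟩ | ⟨h₁, h₂⟩
      · rw [orderOf_refl_mul_refl_eq_two D h₁ h₂]
        simpa [altProd] using 𝒪.gOp_comm h₁ h₂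
      · rw [orderOf_refl_mul_refl_eq_three D h₁ h₂]
        simpa [altProd] using 𝒪.gOp_braid h₁ h₂)
    𝒪.gOp_lusztig
  have : Finite 𝒪.O := 𝒪.finite
  refine ⟨𝒪.O →₀ Cq, inferInstance, inferInstance, inferInstance, ρ, fun x => ?_, 𝒪.δ S, ?_, ?_⟩
  · rw [hρ, eq_top_iff]
    rintro v -
    induction v using Finsupp.induction_linear with
    | zero => exact zero_mem _
    | add f g hf hg => exact add_mem hf hg
    | single S t =>
      refine Submodule.mem_iSup_of_mem (cval (𝒪.ev S) x) ?_
      have : Finsupp.single S t = t • 𝒪.δ S := by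
        rw [δ_coe, Finsupp.smul_single, smul_eq_mul, mul_one]
      rw [Module.End.mem_eigenspace_iff, this, map_smul, xOp_δ, smul_comm]
  · rw [𝒪.δ_coe ⟨S, hS⟩]
    simp
  · intro x
    rw [hρ, xOp_δ]
    rfl

end CalibratedOrbit

/-! ### The root datum of a labelled Dynkin diagram -/

theorem LabelShape.pred_eq_none_iff {s : LabelShape} (i : s.Vert) :
    LabelShape.pred i = none ↔ i = s.vertOne := by
  cases i <;> simp only [pred, vertOne] <;> split_ifs <;> simp_all

section Datum

variable {ι M N : Type*} [AddCommGroup M] [Module ℝ M] [AddCommGroup N] [Module ℝ N]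
variable {P : RootPairing ι ℝ M N} [P.IsCrystallographic] {b : P.Base} {v : b.support}

namespace Labelling

variable (lab : Labelling b v)

theorem datum_root (i : lab.shape.Vert) :
    lab.datum.root i = (0, P.rootSpanMem ℤ (lab.vertex i)) := rfl

theorem datum_coroot_apply_root (i j : lab.shape.Vert) :
    lab.datum.coroot i (lab.datum.root j) = b.cartanMatrix (lab.vertex j) (lab.vertex i) := by
  simp [datum, RootPairing.Base.cartanMatrix, RootPairing.Base.cartanMatrixIn_def,
    RootPairing.coroot'In_rootSpanMem_eq_pairingIn]

theorem datum_coroot_eps (i : lab.shape.Vert) [Decidable (i = lab.shape.vertOne)] :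
    lab.datum.coroot i (eps P) = if i = lab.shape.vertOne then -1 else 0 := by
  simp only [datum, eps, AddMonoidHom.coprod_apply, map_zero, add_zero]
  split_ifs <;> simp

theorem datum_coroot_zero_mk (i : lab.shape.Vert) (u : P.rootSpan ℤ) :
    lab.datum.coroot i (0, u) = P.coroot'In ℤ (lab.vertex i) u := by
  simp [datum]

theorem datum_refl_root (i : lab.shape.Vert) (k : ι) :
    lab.datum.refl i (0, P.rootSpanMem ℤ k) =
      (0, P.rootSpanMem ℤ (P.reflectionPerm (lab.vertex i) k)) := by
  rw [SimpleRootDatum.refl_apply, datum_coroot_zero_mk,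
    RootPairing.coroot'In_rootSpanMem_eq_pairingIn, datum_root, Prod.ext_iff]
  refine ⟨by simp, Subtype.ext ?_⟩
  simp [RootPairing.root_reflectionPerm, RootPairing.reflection_apply_root' ℤ]

theorem adjacent_iff_coroot {i j : lab.shape.Vert} (hij : i ≠ j) :
    lab.datum.coroot i (lab.datum.root j) ≠ 0 ↔
      LabelShape.pred i = some j ∨ LabelShape.pred j = some i := by
  rw [datum_coroot_apply_root, lab.adjacent_iff j i hij.symm, or_comm]

/-- Entries `0` or `-1` alone would allow an asymmetric pair; this is excluded because adjacency in
the labelling is symmetric. -/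
theorem datum_simplyLaced [Finite ι] (hb : b.cartanMatrix.IsSimplyLaced) :
    lab.datum.SimplyLaced := by
  intro i j hij
  have hne : lab.vertex i ≠ lab.vertex j := fun h => hij (lab.vertex.injective h)
  have h₁ := hb hne.symm
  have h₂ := hb hne
  have h₃ := lab.adjacent_iff_coroot hij
  have h₄ := lab.adjacent_iff_coroot hij.symm
  rw [or_comm, ← h₃] at h₄
  simp only [datum_coroot_apply_root] at *
  rcases h₁ with h₁ | h₁ <;> rcases h₂ with h₂ | h₂ <;> simp_all

/-- The positive system of the root datum of a labelling. -/
noncomputable def positiveSystem [Finite ι] [P.IsReduced]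
    (hb : b.cartanMatrix.IsSimplyLaced) : lab.datum.PositiveSystem where
  roots := Set.range fun k : ι => ((0, P.rootSpanMem ℤ k) : ExtLattice P)
  Pos x := ∃ k, x = (0, P.rootSpanMem ℤ k) ∧ b.IsPos k
  -- The linear extension of `α_i ↦ α_i^∨` to the root lattice, with `ε` sent to `0`.
  Λ := ((lab.exists_basis.choose.constr ℤ lab.datum.coroot).toAddMonoidHom).comp
    (AddMonoidHom.snd ℤ (P.rootSpan ℤ))
  root_mem i := ⟨_, rfl⟩
  pos_root i := ⟨_, rfl, RootPairing.Base.isPos_of_mem_support (lab.vertex i).2⟩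
  refl_mem := by
    rintro i _ ⟨k, rfl⟩
    exact ⟨_, (lab.datum_refl_root i k).symm⟩
  pos_neg_iff := by
    rintro _ ⟨k, rfl⟩
    have hinj : ∀ {k k' : ι}, ((0, P.rootSpanMem ℤ k) : ExtLattice P) = (0, P.rootSpanMem ℤ k') →
        k = k' := fun h => P.root.injective (congrArg Subtype.val (congrArg Prod.snd h))
    have hneg : (-(0, P.rootSpanMem ℤ k) : ExtLattice P) =
        (0, P.rootSpanMem ℤ (P.reflectionPerm k k)) := by
      rw [RootPairing.rootSpanMem_reflectionPerm_self]
      simp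
    have h := RootPairing.Base.IsPos.neg_iff_not b k
    rw [hneg]
    constructor
    · rintro ⟨k', hk', hpos⟩ ⟨k'', hk'', hpos'⟩
      rw [← hinj hk'] at hpos
      rw [← hinj hk''] at hpos'
      exact (h.1 hpos) hpos'
    · intro hn
      exact ⟨_, rfl, h.2 fun hpos => hn ⟨k, rfl, hpos⟩⟩
  pos_refl := by
    rintro i _ ⟨_, rfl⟩ ⟨k, hk, hpos⟩ hne
    simp only at hk hne ⊢
    rw [hk] at hne ⊢
    rw [datum_refl_root]
    refine ⟨_, rfl, hpos.reflectionPerm (lab.vertex i).2 ?_⟩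
    rintro rfl
    exact hne rfl
  Λ_root i := by
    simp [datum_root, ← lab.exists_basis.choose_spec i]
  Λ_apply_root := by
    rintro i _ ⟨k, rfl⟩
    have hB := lab.exists_basis.choose_spec
    set B := lab.exists_basis.choose
    let ev : (ExtLattice P →+ ℤ) →+ ℤ := AddMonoidHom.eval (lab.datum.root i)
    -- Both sides are linear on the root lattice, so the claim reduces to the symmetry of the Cartan
    -- matrix on simple roots.
    have : ev.toIntLinearMap ∘ₗ B.constr ℤ lab.datum.coroot =
        P.coroot'In ℤ (lab.vertex i) := by
      refine B.ext fun j => ?_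
      rw [LinearMap.comp_apply, Module.Basis.constr_basis, hB, ← lab.datum_coroot_zero_mk,
        ← datum_root]
      change lab.datum.coroot j (lab.datum.root i) = _
      by_cases hij : i = j
      · rw [hij]
      · rcases lab.datum_simplyLaced hb i j hij with h | h <;> rw [h.1, h.2]
    have := congrArg (fun f => f (P.rootSpanMem ℤ k)) this
    rw [lab.datum_coroot_zero_mk, ← this]
    rfl

theorem finite_vert : Finite lab.shape.Vert := Finite.of_equiv _ lab.vertex.symm

/-! ### Truncated orbits -/

theorem seqEquiv_apply (χ : Character (ExtLattice P)) (j : Option lab.shape.Vert) :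
    ((lab.seqEquiv χ j : Cqˣ) : Cq) = cval χ (lab.delta j) := rfl

theorem seq_apply (S : lab.Seq) (j : Option lab.shape.Vert) :
    (S j : Cq) = cval (lab.seqEquiv.symm S) (lab.delta j) := by
  rw [← seqEquiv_apply, Equiv.apply_symm_apply]

theorem seq_some (S : lab.Seq) (i : lab.shape.Vert) :
    (S (some i) : Cq) = cval (lab.seqEquiv.symm S) (lab.datum.root i) * S (LabelShape.pred i) := by
  rw [seq_apply, delta_some, cval_add, ← seq_apply, mul_comm]

theorem seq_some_eq_iff (S : lab.Seq) (i : lab.shape.Vert) (u : Cqˣ) :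
    S (some i) = u * S (LabelShape.pred i) ↔
      cval (lab.seqEquiv.symm S) (lab.datum.root i) = u := by
  rw [Units.ext_iff, seq_some, Units.val_mul]
  exact ⟨fun h => mul_right_cancel₀ (Units.ne_zero _) h, fun h => by rw [h]⟩

theorem truncRefl_eq_some_iff (i : lab.shape.Vert) (S S' : lab.Seq) :
    lab.truncRefl i (some S) = some S' ↔
      (cval (lab.seqEquiv.symm S) (lab.datum.root i) ≠ (q : Cq) ^ 2 ∧
        cval (lab.seqEquiv.symm S) (lab.datum.root i) ≠ ((q : Cq) ^ 2)⁻¹) ∧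
      S' = lab.act (lab.datum.refl i) S := by
  have h₁ := lab.seq_some_eq_iff S i (q ^ 2)
  have h₂ := lab.seq_some_eq_iff S i (q ^ (-2 : ℤ))
  have h₃ : ((q ^ (-2 : ℤ) : Cqˣ) : Cq) = ((q : Cq) ^ 2)⁻¹ := by
    rw [zpow_neg, Units.val_inv_eq_inv_val]
    norm_cast
  rw [Units.val_pow_eq_pow_val] at h₁
  rw [h₃] at h₂
  rw [truncRefl]
  split_ifs with h
  · rw [h₁, h₂] at h
    simp only [false_iff]
    tauto
  · rw [h₁, h₂, not_or] at h
    rw [Option.some_inj, eq_comm]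
    exact ⟨fun h' => ⟨h, h'⟩, And.right⟩

theorem act_symm (w : ExtLattice P ≃ₗ[ℤ] ExtLattice P) (S : lab.Seq) :
    lab.seqEquiv.symm (lab.act w S) = charAct w (lab.seqEquiv.symm S) := by
  rw [act, Equiv.symm_apply_apply]

theorem act_mul (w w' : ExtLattice P ≃ₗ[ℤ] ExtLattice P) (S : lab.Seq) :
    lab.act (w * w') S = lab.act w (lab.act w' S) := by
  rw [act, charAct_mul, ← act_symm]
  rfl

theorem act_one (S : lab.Seq) : lab.act 1 S = S := by
  rw [act, charAct_one, Equiv.apply_symm_apply]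

/-- The truncated product of a word does not vanish exactly if the values of the character at
the roots attached to the word are different from `q^{±2}`. -/
theorem truncWord_eq_some_iff (a : List lab.shape.Vert) (S S' : lab.Seq) :
    lab.truncWord a (some S) = some S' ↔
      (∀ β ∈ lab.datum.invs a, cval (lab.seqEquiv.symm S) β ≠ (q : Cq) ^ 2 ∧
        cval (lab.seqEquiv.symm S) β ≠ ((q : Cq) ^ 2)⁻¹) ∧
      S' = lab.act (lab.datum.wordProd a) S := by
  induction a generalizing S' with
  | nil =>
    simp [truncWord, SimpleRootDatum.invs, SimpleRootDatum.wordProd_nil, act_one, eq_comm]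
  | cons i a ih =>
    have hcons : lab.truncWord (i :: a) (some S) = lab.truncRefl i (lab.truncWord a (some S)) := rfl
    rw [hcons]
    rcases h : lab.truncWord a (some S) with _ | S₁
    · simp only [truncRefl, reduceCtorEq, false_iff, not_and]
      intro hall
      have := (ih (lab.act (lab.datum.wordProd a) S)).2
        ⟨fun β hβ => hall β (List.mem_cons_of_mem _ hβ), rfl⟩
      rw [h] at this
      exact absurd this (by simp)
    · obtain ⟨h₁, h₂⟩ := (ih S₁).1 h
      rw [truncRefl_eq_some_iff, h₂, act_symm, cval_charAct, SimpleRootDatum.wordProd_cons,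
        act_mul, SimpleRootDatum.invs, List.forall_mem_cons]
      tauto

/-- Words need not be reduced: the roots attached to a reduced word for the same element occur up to
sign among those of the given word, and avoiding `{q², q⁻²}` does not depend on the sign. -/
theorem truncWord_mem_truncOrbit [Finite ι] [P.IsReduced] (hb : b.cartanMatrix.IsSimplyLaced)
    {a : List lab.shape.Vert} {S S' : lab.Seq} (h : lab.truncWord a (some S) = some S') :
    S' ∈ lab.truncOrbit S := by
  obtain ⟨a', ha'⟩ := lab.datum.exists_reduced_of_word a
  obtain ⟨h₁, h₂⟩ := (lab.truncWord_eq_some_iff a S S').1 h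
  refine ⟨_, lab.datum.wordProd_mem a, a', ha', (lab.truncWord_eq_some_iff a' S S').2
    ⟨fun β hβ => ?_, by rw [h₂, ha'.1]⟩⟩
  rcases (lab.positiveSystem hb).mem_invs_of_reduced ha' rfl hβ with hβ | hβ
  · exact h₁ β hβ
  · have := h₁ _ hβ
    rw [cval_neg, ne_eq, inv_eq_iff_eq_inv, ne_eq, inv_inj] at this
    exact this.symm

theorem self_mem_truncOrbit [Finite ι] [P.IsReduced] (hb : b.cartanMatrix.IsSimplyLaced)
    (S : lab.Seq) : S ∈ lab.truncOrbit S :=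
  lab.truncWord_mem_truncOrbit hb (a := []) rfl

theorem truncRefl_mem_truncOrbit [Finite ι] [P.IsReduced] (hb : b.cartanMatrix.IsSimplyLaced)
    {i : lab.shape.Vert} {S S₁ S₂ : lab.Seq} (h₁ : S₁ ∈ lab.truncOrbit S)
    (h₂ : lab.truncRefl i (some S₁) = some S₂) : S₂ ∈ lab.truncOrbit S := by
  obtain ⟨w, -, a, -, ha⟩ := h₁
  refine lab.truncWord_mem_truncOrbit hb (a := i :: a) ?_
  rw [← h₂, ← ha]
  rfl

theorem truncOrbit_subset [Finite ι] [P.IsReduced] (hb : b.cartanMatrix.IsSimplyLaced)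
    {S S₁ : lab.Seq} (h : S₁ ∈ lab.truncOrbit S) : lab.truncOrbit S₁ ⊆ lab.truncOrbit S := by
  rintro S₂ ⟨w, -, a, -, ha⟩
  induction a generalizing S₂ with
  | nil => exact (Option.some.inj ha) ▸ h
  | cons i a ih =>
    rcases h' : lab.truncWord a (some S₁) with _ | S₃
    · have : lab.truncWord (i :: a) (some S₁) = lab.truncRefl i (lab.truncWord a (some S₁)) := rfl
      rw [this, h'] at ha
      simp [truncRefl] at ha
    · refine lab.truncRefl_mem_truncOrbit hb (ih h') (i := i) ?_
      rw [← h', ← ha]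
      rfl

theorem finite_truncOrbit [Finite ι] [P.IsReduced] (hb : b.cartanMatrix.IsSimplyLaced)
    (S : lab.Seq) : (lab.truncOrbit S).Finite := by
  have := lab.finite_vert
  -- The default `S` plays no role: elements of the orbit come from words with a nonzero value.
  refine (((lab.positiveSystem hb).finite_reduced (Set.finite_range _)).image
    fun a => (lab.truncWord a (some S)).getD S).subset ?_
  rintro S' ⟨w, -, a, ha, h⟩
  exact ⟨a, ⟨w, ha⟩, by simp [h]⟩

/-! ### The calibrated spectrum in terms of truncated orbits -/

/-- Entries of the sequence at labels of distance one or two on a line starting at `0`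
are different. -/
def IsRegular (S : lab.Seq) : Prop :=
  (∀ i, S (some i) ≠ S (LabelShape.pred i)) ∧
    ∀ i j, LabelShape.pred i = some j → S (some i) ≠ S (LabelShape.pred j)

/-- The quotient `s_i / s_{i-1}` is `χ(α_i)`, and for `j = i - 1` the quotient `s_i / s_{j-1}` is
`χ(α_i + α_j)`. Edges of the diagram are exactly the pairs of a label and its predecessor. -/
theorem isRegular_iff [Finite ι] (hb : b.cartanMatrix.IsSimplyLaced) (S : lab.Seq) :
    lab.IsRegular S ↔ (∀ i, cval (lab.seqEquiv.symm S) (lab.datum.root i) ≠ 1) ∧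
      ∀ i j, lab.datum.coroot i (lab.datum.root j) = -1 →
        cval (lab.seqEquiv.symm S) (lab.datum.root i) *
          cval (lab.seqEquiv.symm S) (lab.datum.root j) ≠ 1 := by
  refine and_congr (forall_congr' fun i => ?_) ⟨fun h i j hij => ?_, fun h i j hij h' => ?_⟩
  · simpa using (lab.seq_some_eq_iff S i 1).not
  · have key : ∀ i j, LabelShape.pred i = some j → cval (lab.seqEquiv.symm S) (lab.datum.root i) *
        cval (lab.seqEquiv.symm S) (lab.datum.root j) ≠ 1 := by
      intro i j hp h'
      apply h i j hp
      rw [Units.ext_iff, seq_some, hp, seq_some, ← mul_assoc, h', one_mul]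
    have hne : i ≠ j := by
      rintro rfl
      rw [lab.datum.coroot_root_self] at hij
      omega
    rcases (lab.adjacent_iff_coroot hne).1 (by rw [hij]; decide) with hp | hp
    · exact key i j hp
    · rw [mul_comm]
      exact key j i hp
  · have hne : i ≠ j := by
      rintro rfl
      have := LabelShape.num_pred_lt i
      rw [hij] at this
      exact lt_irrefl _ this
    have hc := (lab.adjacent_iff_coroot hne).2 (.inl hij)
    refine h i j ?_ ?_
    · rcases lab.datum_simplyLaced hb i j hne with h'' | h''
      · exact absurd h''.1 hc
      · exact h''.1
    · rw [Units.ext_iff, seq_some, hij, seq_some, ← mul_assoc] at h'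
      exact mul_eq_right₀ (Units.ne_zero _) |>.1 h'

/-- Weights of a calibrated representation propagate along truncated words and are regular.
Conversely, regularity provides precisely the nonvanishing conditions under which the seminormal
formulas define a module on the orbit. -/
theorem mem_CSpec_iff [Finite ι] [P.IsReduced] (hb : b.cartanMatrix.IsSimplyLaced)
    (χ : Character (ExtLattice P)) :
    χ ∈ CSpec lab.datum ↔ ∀ S ∈ lab.truncOrbit (lab.seqEquiv χ), lab.IsRegular S := by
  constructor
  · rintro ⟨V, _, _, _, ρ, hρ, w, hw, hχ⟩ S ⟨w', -, a, -, ha⟩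
    have key : ∃ w, IsWeightVector ρ (lab.seqEquiv.symm S) w := by
      clear w'
      induction a generalizing S with
      | nil =>
        refine ⟨w, hw, ?_⟩
        rw [← Option.some.inj ha, Equiv.symm_apply_apply]
        exact hχ
      | cons i a ih =>
        have hcons : lab.truncWord (i :: a) (some (lab.seqEquiv χ)) =
          lab.truncRefl i (lab.truncWord a (some (lab.seqEquiv χ))) := rfl
        rw [hcons] at ha
        rcases h' : lab.truncWord a (some (lab.seqEquiv χ)) with _ | S₁
        · rw [h'] at ha
          simp [truncRefl] at ha
        · rw [h', truncRefl_eq_some_iff] at ha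
          obtain ⟨w₁, hw₁⟩ := ih S₁ h'
          rw [ha.2, act_symm]
          exact hw₁.exists_refl hρ ha.1.1 ha.1.2
    obtain ⟨w, hw⟩ := key
    rw [lab.isRegular_iff hb]
    refine ⟨hw.cval_root_ne_one hρ, fun i j hij => ?_⟩
    have hne : i ≠ j := by
      rintro rfl
      rw [lab.datum.coroot_root_self] at hij
      omega
    refine hw.cval_root_add_root_ne_one hρ hne hij ?_
    rcases lab.datum_simplyLaced hb i j hne with h | h
    · omega
    · exact h.2
  · intro h
    let 𝒪 : CalibratedOrbit lab.datum lab.Seq :=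
      { ev := lab.seqEquiv.symm
        ev_injective := lab.seqEquiv.symm.injective
        s := fun i => lab.act (lab.datum.refl i)
        ev_s := fun i S => lab.act_symm _ S
        O := lab.truncOrbit (lab.seqEquiv χ)
        finite := lab.finite_truncOrbit hb _
        root_ne_one := fun S hS => ((lab.isRegular_iff hb S).1 (h S hS)).1
        root_add_root_ne_one := fun S hS => ((lab.isRegular_iff hb S).1 (h S hS)).2
        closed := fun S hS i h₁ h₂ => lab.truncRefl_mem_truncOrbit hb hS
          ((lab.truncRefl_eq_some_iff i S _).2 ⟨⟨h₁, h₂⟩, rfl⟩) }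
    have := 𝒪.ev_mem_CSpec (lab.datum_simplyLaced hb) (lab.self_mem_truncOrbit hb (lab.seqEquiv χ))
    simpa [𝒪] using this

end Labelling

end Datum

/-! ### Lines of labels -/

/-- A sequence of labels that starts at `0` and in which every entry is the predecessor of
the next one. -/
structure LabelShape.IsLine (s : LabelShape) (p : ℕ → Option s.Vert) (N : ℕ) : Prop where
  zero : p 0 = none
  succ : ∀ a < N, ∃ i, p (a + 1) = some i ∧ LabelShape.pred i = p a

namespace LabelShape

variable (s : LabelShape)

/-- The line `0, 1, …, l`. -/
def mainLine (a : ℕ) : Option s.Vert :=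
  if h : 1 ≤ a ∧ a ≤ s.l then some (.main a h.1 h.2) else none

/-- The line `0, 1, 2̲, …, l̲'`. -/
def undLine (a : ℕ) : Option s.Vert :=
  if a = 1 then some s.vertOne else
    if h : 2 ≤ a ∧ a ≤ s.l' then some (.und a h.1 h.2) else none

/-- The line `0, 1, …, k` continued by the doubly underlined labels `k + 1, …, l''`. -/
def dundLine (a : ℕ) : Option s.Vert :=
  if h : 1 ≤ a ∧ a ≤ s.k then some (.main a h.1 (h.2.trans s.k_le_l)) else
    if h : s.k + 1 ≤ a ∧ a ≤ s.l'' then some (.dund a h.1 h.2) else none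

theorem isLine_mainLine : s.IsLine s.mainLine s.l where
  zero := by simp [mainLine]
  succ a ha := by
    refine ⟨.main (a + 1) (by omega) (by omega), dif_pos ⟨by omega, by omega⟩, ?_⟩
    rw [pred, mainLine]
    by_cases h : a = 0
    · simp [h]
    · rw [dif_neg (by omega), dif_pos ⟨by omega, by omega⟩]
      simp

theorem isLine_undLine : s.IsLine s.undLine s.l' where
  zero := by simp [undLine]
  succ a ha := by
    by_cases h₀ : a = 0
    · subst h₀
      exact ⟨s.vertOne, by simp [undLine], by simp [pred, vertOne, undLine]⟩
    refine ⟨.und (a + 1) (by omega) (by omega), ?_, ?_⟩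
    · rw [undLine, if_neg (by omega), dif_pos ⟨by omega, by omega⟩]
    · rw [pred, undLine]
      by_cases h : a = 1
      · simp [h]
      · rw [dif_neg (by omega), if_neg h, dif_pos ⟨by omega, by omega⟩]
        simp

theorem isLine_dundLine : s.IsLine s.dundLine s.l'' where
  zero := by simp [dundLine]
  succ a ha := by
    have := s.k_le_l
    have := s.one_le_k
    by_cases hk : a < s.k
    · refine ⟨.main (a + 1) (by omega) (by omega), dif_pos ⟨by omega, by omega⟩, ?_⟩
      rw [pred, dundLine]
      by_cases h : a = 0
      · simp [h]
      · rw [dif_neg (by omega), dif_pos ⟨by omega, by omega⟩]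
        simp
    · refine ⟨.dund (a + 1) (by omega) (by omega), ?_, ?_⟩
      · rw [dundLine, dif_neg (by omega), dif_pos ⟨by omega, by omega⟩]
      · rw [pred, dundLine]
        by_cases h : a = s.k
        · subst h
          rw [dif_pos rfl, dif_pos ⟨by omega, by omega⟩]
        · rw [dif_neg (by omega), dif_neg (by omega), dif_pos ⟨by omega, by omega⟩]
          simp

theorem undLine_eq_mainLine {a : ℕ} (ha : a ≤ 1) : s.undLine a = s.mainLine a := by
  have := s.one_le_l
  interval_cases a
  · simp [undLine, mainLine]
  · rw [undLine, if_pos rfl, mainLine, dif_pos ⟨le_rfl, this⟩]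
    rfl

theorem dundLine_eq_mainLine {a : ℕ} (ha : a ≤ s.k) : s.dundLine a = s.mainLine a := by
  have := s.k_le_l
  rw [dundLine, mainLine]
  by_cases h : 1 ≤ a
  · rw [dif_pos ⟨h, ha⟩, dif_pos ⟨h, by omega⟩]
  · rw [dif_neg (by omega), dif_neg (by omega), dif_neg (by omega)]

theorem mainLine_main {a : ℕ} (h₁ : 1 ≤ a) (h₂ : a ≤ s.l) :
    s.mainLine a = some (.main a h₁ h₂) := dif_pos ⟨h₁, h₂⟩

theorem undLine_und {a : ℕ} (h₁ : 2 ≤ a) (h₂ : a ≤ s.l') :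
    s.undLine a = some (.und a h₁ h₂) := by
  rw [undLine, if_neg (by omega), dif_pos ⟨h₁, h₂⟩]

theorem dundLine_dund {a : ℕ} (h₁ : s.k + 1 ≤ a) (h₂ : a ≤ s.l'') :
    s.dundLine a = some (.dund a h₁ h₂) := by
  rw [dundLine, dif_neg (by omega), dif_pos ⟨h₁, h₂⟩]

end LabelShape

/-! ### Contents of tableaux of type `(R, v)` -/

namespace STabType

variable {s : LabelShape} (T : STabType s)

theorem content_main (a : Fin (s.l + 1)) : T.T₁.content a = T.seq (s.mainLine a) := by
  obtain ⟨a, ha⟩ := a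
  by_cases h : a = 0
  · subst h
    simp [LabelShape.mainLine, seq]
  · rw [s.mainLine_main (a := a) (by omega) (by omega)]
    rfl

theorem content_und (a : Fin (s.l' + 1)) : T.T₂.content a = T.seq (s.undLine a) := by
  obtain ⟨a, ha⟩ := a
  by_cases h : a ≤ 1
  · rw [s.undLine_eq_mainLine h]
    have hl := s.one_le_l
    have := T.content_main ⟨a, by omega⟩
    simp only at this ⊢
    rw [← this]
    have h₂ := congrArg (fun T => T.content ⟨a, by omega⟩) T.agree₂
    simp only [STab.content_trunc] at h₂
    exact h₂.symm
  · rw [s.undLine_und (a := a) (by omega) (by omega)]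
    rfl

theorem content_dund (a : Fin (s.l'' + 1)) : T.T₃.content a = T.seq (s.dundLine a) := by
  obtain ⟨a, ha⟩ := a
  by_cases h : a ≤ s.k
  · rw [s.dundLine_eq_mainLine h]
    have hl := s.k_le_l
    have := T.content_main ⟨a, by omega⟩
    simp only at this ⊢
    rw [← this]
    have h₂ := congrArg (fun T => T.content ⟨a, by omega⟩) T.agree₃
    simp only [STab.content_trunc] at h₂
    exact h₂.symm
  · rw [s.dundLine_dund (a := a) (by omega) (by omega)]
    rfl

/-- Each component is determined by its contents, which `seq` lists along one line; the entries
missing from the second and third blocks of labels are supplied by the agreement conditions. -/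
theorem seq_injective : Function.Injective (STabType.seq (s := s)) := by
  intro T T' h
  ext1
  · exact STab.content_injective (funext fun a => by rw [content_main, content_main, h])
  · exact STab.content_injective (funext fun a => by rw [content_und, content_und, h])
  · exact STab.content_injective (funext fun a => by rw [content_dund, content_dund, h])

/-- Every label lies on a line whose contents are those of one of the three tableaux. -/
theorem exists_line (i : s.Vert) : ∃ (p : ℕ → Option s.Vert) (N : ℕ) (U : STab (N + 1)) (a : ℕ),
    s.IsLine p N ∧ a < N ∧ p (a + 1) = some i ∧ ∀ c : Fin (N + 1), U.content c = T.seq (p c) := by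
  have := s.one_le_k
  cases i with
  | main a h₁ h₂ =>
    obtain ⟨a, rfl⟩ : ∃ a', a = a' + 1 := ⟨a - 1, by omega⟩
    exact ⟨_, _, T.T₁, a, s.isLine_mainLine, by omega, s.mainLine_main h₁ h₂, T.content_main⟩
  | und a h₁ h₂ =>
    obtain ⟨a, rfl⟩ : ∃ a', a = a' + 1 := ⟨a - 1, by omega⟩
    exact ⟨_, _, T.T₂, a, s.isLine_undLine, by omega, s.undLine_und h₁ h₂, T.content_und⟩
  | dund a h₁ h₂ =>
    obtain ⟨a, rfl⟩ : ∃ a', a = a' + 1 := ⟨a - 1, by omega⟩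
    exact ⟨_, _, T.T₃, a, s.isLine_dundLine, by omega, s.dundLine_dund h₁ h₂, T.content_dund⟩

theorem seq_ne_pred (i : s.Vert) : T.seq (some i) ≠ T.seq (LabelShape.pred i) := by
  obtain ⟨p, N, U, a, hp, ha, hi, hU⟩ := T.exists_line i
  obtain ⟨i', hi', hpred⟩ := hp.succ a ha
  obtain rfl : i' = i := Option.some.inj (hi'.symm.trans hi)
  have h₁ := hU ⟨a, by omega⟩
  have h₂ := hU ⟨a + 1, by omega⟩
  simp only at h₁ h₂
  rw [hpred, ← hi, ← h₁, ← h₂]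
  exact U.content_succ_ne rfl

theorem seq_ne_pred_pred {i j : s.Vert} (hij : LabelShape.pred i = some j) :
    T.seq (some i) ≠ T.seq (LabelShape.pred j) := by
  obtain ⟨p, N, U, a, hp, ha, hi, hU⟩ := T.exists_line i
  obtain ⟨i', hi', hpred⟩ := hp.succ a ha
  obtain rfl : i' = i := Option.some.inj (hi'.symm.trans hi)
  obtain _ | a := a
  · rw [hp.zero, hij] at hpred
    simp at hpred
  obtain ⟨j', hj', hpredj⟩ := hp.succ a (by omega)
  obtain rfl : j' = j := Option.some.inj (by rw [← hij, hpred, hj'])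
  have h₁ := hU ⟨a, by omega⟩
  have h₂ := hU ⟨a + 2, by omega⟩
  simp only at h₁ h₂
  rw [hpredj, ← hi, ← h₁, ← h₂]
  exact U.content_succ_succ_ne (m := ⟨a + 1, by omega⟩) rfl rfl

end STabType

section Datum

variable {ι M N : Type*} [AddCommGroup M] [Module ℝ M] [AddCommGroup N] [Module ℝ N]
variable {P : RootPairing ι ℝ M N} [P.IsCrystallographic] {b : P.Base} {v : b.support}

namespace Labelling

variable (lab : Labelling b v)

/-- The coroots of a line pair with the vectors `δ` of the line as in type `GL`. -/
theorem coroot_delta_line [Finite ι] (hb : b.cartanMatrix.IsSimplyLaced)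
    {p : ℕ → Option lab.shape.Vert} {n : ℕ} (hp : lab.shape.IsLine p n) {a c : ℕ} (ha : a < n)
    (hc : c ≤ n) {i : lab.shape.Vert} (hi : p (a + 1) = some i) :
    lab.datum.coroot i (lab.delta (p c)) = if c = a + 1 then 1 else if c = a then -1 else 0 := by
  classical
  -- The numbers carried by the labels increase along the line, so its entries are distinct.
  have hnum : ∀ d ≤ n, ∀ e < d, LabelShape.num (p e) < LabelShape.num (p d) := by
    intro d hd e he
    induction d with
    | zero => omega
    | succ d ih =>
      obtain ⟨j, hj, hpred⟩ := hp.succ d (by omega)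
      have h := LabelShape.num_pred_lt j
      rw [hpred, ← hj] at h
      rcases Nat.lt_succ_iff_lt_or_eq.1 he with he | rfl
      · exact (ih (by omega) he).trans h
      · exact h
  have hinj : ∀ d ≤ n, ∀ e ≤ n, p d = p e → d = e := by
    intro d hd e he h
    rcases lt_trichotomy d e with hlt | rfl | hlt
    · exact absurd (h ▸ hnum e he d hlt) (lt_irrefl _)
    · rfl
    · exact absurd (h ▸ hnum d hd e hlt) (lt_irrefl _)
  obtain ⟨i', hi', hpi⟩ := hp.succ a ha
  obtain rfl : i' = i := Option.some.inj (hi'.symm.trans hi)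
  induction c with
  | zero =>
    have h0 : i' = lab.shape.vertOne ↔ a = 0 := by
      rw [← LabelShape.pred_eq_none_iff, hpi, ← hp.zero]
      exact ⟨fun h => hinj a (by omega) 0 (by omega) h, fun h => by rw [h]⟩
    rw [hp.zero, delta_none, datum_coroot_eps]
    simp only [h0]
    rcases eq_or_ne a 0 with rfl | h
    · simp
    · simp [h, h.symm]
  | succ c ih =>
    obtain ⟨j, hj, hpj⟩ := hp.succ c (by omega)
    rw [hj, delta_some, map_add, hpj, ih (by omega)]
    -- Passing from `δ` at `c` to `δ` at `c + 1` adds `α_i^∨(α_j)`: this is `2` for `j = i`, `-1` if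
    -- `c + 1` is next to `a + 1` on the line, and `0` otherwise.
    by_cases hij : i' = j
    · have hac : a + 1 = c + 1 := hinj _ (by omega) _ hc (by rw [hi, hj, hij])
      rw [← hij, lab.datum.coroot_root_self]
      split_ifs <;> omega
    · have hadj := lab.adjacent_iff_coroot hij
      rw [hpi, hpj, ← hi, ← hj] at hadj
      have e₁ : p a = p (c + 1) ↔ a = c + 1 :=
        ⟨fun h => hinj _ (by omega) _ hc h, fun h => by rw [h]⟩
      have e₂ : p c = p (a + 1) ↔ c = a + 1 :=
        ⟨fun h => hinj _ (by omega) _ (by omega) h, fun h => by rw [h]⟩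
      rw [e₁, e₂] at hadj
      have hac : a ≠ c := by
        rintro rfl
        exact hij (Option.some.inj (hi.symm.trans hj))
      rcases lab.datum_simplyLaced hb i' j hij with h | h
      · have := hadj.not.1 (by rw [h.1]; simp)
        rw [h.1]
        split_ifs <;> omega
      · have := hadj.1 (by rw [h.1]; decide)
        rw [h.1]
        split_ifs <;> omega

/-- The reflections of a line exchange neighbouring entries of the line. -/
theorem act_refl_line [Finite ι] (hb : b.cartanMatrix.IsSimplyLaced)
    {p : ℕ → Option lab.shape.Vert} {n : ℕ} (hp : lab.shape.IsLine p n) {a : ℕ} (ha : a < n)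
    {i : lab.shape.Vert} (hi : p (a + 1) = some i) (S : lab.Seq) :
    lab.act (lab.datum.refl i) S (p a) = S (p (a + 1)) ∧
      lab.act (lab.datum.refl i) S (p (a + 1)) = S (p a) ∧
      ∀ c ≤ n, c ≠ a → c ≠ a + 1 → lab.act (lab.datum.refl i) S (p c) = S (p c) := by
  have key : ∀ j j', lab.datum.refl i (lab.delta j) = lab.delta j' →
      lab.act (lab.datum.refl i) S j = S j' := by
    intro j j' h
    rw [Units.ext_iff, seq_apply, seq_apply, act_symm, cval_charAct_refl, h]
  obtain ⟨i', hi', hpi⟩ := hp.succ a ha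
  obtain rfl : i' = i := Option.some.inj (hi'.symm.trans hi)
  have hδ : lab.delta (p (a + 1)) = lab.delta (p a) + lab.datum.root i' := by
    rw [hi, delta_some, hpi]
  refine ⟨key _ _ ?_, key _ _ ?_, fun c hc h₁ h₂ => key _ _ ?_⟩
  · rw [SimpleRootDatum.refl_apply, lab.coroot_delta_line hb hp ha (by omega) hi, hδ]
    simp
  · rw [SimpleRootDatum.refl_apply, lab.coroot_delta_line hb hp ha (by omega) hi, hδ]
    simp
  · rw [SimpleRootDatum.refl_apply, lab.coroot_delta_line hb hp ha hc hi, if_neg h₂, if_neg h₁]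
    simp

/-- If all sequences of the truncated orbit are regular then the entries on every line are
the contents of a standard tableau. -/
theorem exists_stab_line [Finite ι] [P.IsReduced] (hb : b.cartanMatrix.IsSimplyLaced)
    {S : lab.Seq} (hS : ∀ S' ∈ lab.truncOrbit S, lab.IsRegular S')
    {p : ℕ → Option lab.shape.Vert} {n : ℕ} (hp : lab.shape.IsLine p n) :
    ∃ U : STab (n + 1), ∀ c : Fin (n + 1), U.content c = S (p c) := by
  -- The family closed under exchanges is the truncated orbit itself, read along the line.
  have hbetween := fun i j : ℕ => exists_between_of_swap_closed (i := i) (j := j)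
    (fun (S' : lab.truncOrbit S) c => (S' : lab.Seq) (p c)) n
    (fun S' a ha => by
      obtain ⟨i, hi, hpi⟩ := hp.succ a ha
      rw [hi, ← hpi]
      exact ((hS S' S'.2).1 i).symm)
    (fun S' a ha => by
      obtain ⟨i, hi, hpi⟩ := hp.succ (a + 1) ha
      obtain ⟨j, hj, hpj⟩ := hp.succ a (by omega)
      rw [hi, ← hpj]
      exact ((hS S' S'.2).2 i j (hpi.trans hj)).symm)
    (fun S' a ha h₁ h₂ => by
      obtain ⟨i, hi, hpi⟩ := hp.succ a ha
      have hact := lab.act_refl_line hb hp ha hi S'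
      refine ⟨⟨lab.act (lab.datum.refl i) S', lab.truncRefl_mem_truncOrbit hb S'.2 (i := i) ?_⟩,
        hact.1, hact.2.1, hact.2.2⟩
      simp only [hi, ← hpi] at h₁ h₂
      rw [zpow_ofNat] at h₁
      rw [truncRefl, if_neg (not_or.2 ⟨h₁, h₂⟩)])
    ⟨S, lab.self_mem_truncOrbit hb S⟩
  obtain ⟨F, hF, hFc⟩ := exists_filling (fun c => S (p c)) (n + 1) fun i j hij hj h u hu =>
    hbetween i j hij (by omega) h hu
  exact ⟨Quot.mk _ ⟨F, hF⟩, hFc⟩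

/-- The three lines cover all labels. Restrictions to their common initial segments have equal
contents, hence are equal tableaux. -/
theorem exists_stabType [Finite ι] [P.IsReduced] (hb : b.cartanMatrix.IsSimplyLaced)
    {S : lab.Seq} (hS : ∀ S' ∈ lab.truncOrbit S, lab.IsRegular S') :
    ∃ T : STabType lab.shape, S = T.seq := by
  obtain ⟨T₁, h₁⟩ := lab.exists_stab_line hb hS lab.shape.isLine_mainLine
  obtain ⟨T₂, h₂⟩ := lab.exists_stab_line hb hS lab.shape.isLine_undLine
  obtain ⟨T₃, h₃⟩ := lab.exists_stab_line hb hS lab.shape.isLine_dundLine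
  refine ⟨⟨T₁, T₂, T₃, STab.content_injective (funext fun a => ?_),
    STab.content_injective (funext fun a => ?_)⟩, funext fun j => ?_⟩
  · rw [STab.content_trunc, STab.content_trunc, h₁, h₂]
    simp only [Fin.val_castLE]
    rw [lab.shape.undLine_eq_mainLine (by omega)]
  · rw [STab.content_trunc, STab.content_trunc, h₁, h₃]
    simp only [Fin.val_castLE]
    rw [lab.shape.dundLine_eq_mainLine (by omega)]
  · rcases j with _ | j
    · exact (h₁ 0).symm
    cases j with
    | main a h h' => exact (((h₁ _).trans (by rw [lab.shape.mainLine_main h h']))).symm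
    | und a h h' => exact (((h₂ _).trans (by rw [lab.shape.undLine_und h h']))).symm
    | dund a h h' => exact (((h₃ _).trans (by rw [lab.shape.dundLine_dund h h']))).symm

/-- The calibrated spectrum consists of the characters of admissible tableaux. -/
theorem mem_CSpec_iff_exists_ASTab [Finite ι] [P.IsReduced] (hb : b.cartanMatrix.IsSimplyLaced)
    (χ : Character (ExtLattice P)) :
    χ ∈ CSpec lab.datum ↔ ∃ T ∈ lab.ASTab, lab.seqEquiv χ = T.seq := by
  rw [lab.mem_CSpec_iff hb]
  constructor
  · intro h
    obtain ⟨T, hT⟩ := lab.exists_stabType hb h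
    refine ⟨T, fun S hS => ?_, hT⟩
    rw [← hT] at hS
    -- Regularity of the orbit is inherited by the orbit of each of its elements, so every element
    -- is itself a content sequence.
    exact lab.exists_stabType hb fun S' hS' => h S' (lab.truncOrbit_subset hb hS hS')
  · rintro ⟨T, hT, hχ⟩ S hS
    rw [hχ] at hS
    obtain ⟨T', rfl⟩ := hT S hS
    exact ⟨T'.seq_ne_pred, fun _ _ hij => T'.seq_ne_pred_pred hij⟩

end Labelling

end Datum

end CalibratedHecke

theorem theorem6p2 {ι M N : Type*} [Finite ι] [AddCommGroup M] [Module ℝ M]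
    [AddCommGroup N] [Module ℝ N] (P : RootPairing ι ℝ M N) [P.IsRootSystem]
    [P.IsCrystallographic] [P.IsReduced] [P.IsIrreducible] (b : P.Base)
    (hb : b.cartanMatrix.IsSimplyLaced) (v : b.support)
    (lab : CalibratedHecke.Labelling b v) :
    (∃ Φ : CalibratedHecke.CSpec lab.datum ≃ lab.ASTab,
      ∀ χ : CalibratedHecke.CSpec lab.datum, lab.seqEquiv χ.1 = (Φ χ).1.seq) ∧
    lab.CEig = {S | ∃ T ∈ lab.ASTab, S = T.seq} := by
  have hiff := lab.mem_CSpec_iff_exists_ASTab hb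
  refine ⟨?_, ?_⟩
  · choose f hf hseq using fun χ : CalibratedHecke.CSpec lab.datum => (hiff χ).1 χ.2
    refine ⟨Equiv.ofBijective (fun χ => ⟨f χ, hf χ⟩) ⟨fun χ χ' h => ?_, fun T => ?_⟩, hseq⟩
    · have h' : f χ = f χ' := congrArg Subtype.val h
      exact Subtype.ext (lab.seqEquiv.injective (by rw [hseq, hseq, h']))
    · have hT : lab.seqEquiv (lab.seqEquiv.symm T.1.seq) = T.1.seq :=
        lab.seqEquiv.apply_symm_apply _
      refine ⟨⟨_, (hiff _).2 ⟨T, T.2, hT⟩⟩, Subtype.ext ?_⟩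
      exact CalibratedHecke.STabType.seq_injective ((hseq _).symm.trans hT)
  · ext S
    constructor
    · rintro ⟨χ, hχ, rfl⟩
      exact (hiff χ).1 hχ
    · intro hS
      refine ⟨lab.seqEquiv.symm S, (hiff _).2 ?_, lab.seqEquiv.apply_symm_apply S⟩
      rwa [lab.seqEquiv.apply_symm_apply]
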